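/- Let $(M,\omega)$ be a smooth symplectic manifold of dimension $2n$ (Hausdorff, second countable, without boundary), let $V\subset TM$ be a smooth symplectic distribution of rank $2k$ (each $V_x$ is a $2k$-dimensional subspace of $T_xM$ on which $\omega_x$ is nondegenerate; $V$ need not be integrable), and let $H\in C^\infty(M)$. Let $X_H$ be the Hamiltonian vector field, $i_{X_H}\omega=-dH$, let $\pi_V:TM\to TM$ be the projection onto $V$ whose kernel is the $\omega$-orthogonal complement of $V$, and put $X_H^V=\pi_V(X_H)$. Let $$\mathfrak C=\{x\in M : X_H^V(x)=0\}$$ be the critical set of the constrained Hamiltonian system. A local spanning family of $V$ over an open set $U\subset M$ consists of smooth vector fields $Y_1,\dots,Y_{2k}$ on $U$ that span $V_x$ for every $x\in U$; write $F=(Y_1(H),\dots,Y_{2k}(H)):U\to\mathbb R^{2k}$. Submanifolds are smooth and embedded, and the empty set is a submanifold of every dimension. Then: 1. Every point of $M$ has an open neighbourhood $U$ over which $V$ has a local spanning family. For every local spanning family over an open set $U$, the map $F$ is smooth and $\mathfrak C\cap U=F^{-1}(0)$. 2. For every local spanning family over an open set $U$, Lebesgue-almost every $c\in\mathbb R^{2k}$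 is a regular value of $F$, the regular values are dense in $\mathbb R^{2k}$, and for every regular value $c$ the set $F^{-1}(c)$ is a submanifold of $M$ of dimension $2(n-k)$. 3. Let $\mathfrak C_{gen}$ be the set of points $x\in\mathfrak C$ at which, for some local spanning family near $x$, the differential of $F$ is surjective. Then $\mathfrak C_{gen}$ is relatively open in $\mathfrak C$ and is a submanifold of $M$ of dimension $2(n-k)$. 4. Call $H$ generic if $0$ is a regular value of $F$ for every local spanning family of $V$. Then $H$ is generic if and only if $\mathfrak C_{gen}=\mathfrak C$, and if $H$ is generic, then $\mathfrak C$ is a submanifold of $M$ of dimension $2(n-k)$. 5. Let $f_1,\dots,f_N\in C^\infty(M)$ be such that for every $x\in M$ no nonzero vector of $V_x$ is annihilated by all of $df_1(x),\dots,df_N(x)$. Then for Lebesgue-almost every $t\in\mathbb R^N$ the Hamiltonian $H+\sum_j t_jf_j$ is generic, and in particular its critical set $\{x : X^V_{H+\sum_j t_jf_j}(x)=0\}$ is a submanifold of $M$ of dimension $2(n-k)$. -/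

import Mathlib

open scoped Manifold ContDiff

noncomputable section

namespace ConstrainedHamiltonian

section

variable {n : ℕ} {M : Type*} [TopologicalSpace M] [ChartedSpace (EuclideanSpace ℝ (Fin (2 * n))) M]
  [IsManifold (𝓡 (2 * n)) ∞ M]

/-- The vector field `X` is of class `C^∞` on the set `U`. -/
def IsSmoothFieldOn (X : ∀ x : M, TangentSpace (𝓡 (2 * n)) x) (U : Set M) : Prop :=
  ContMDiffOn (𝓡 (2 * n)) (𝓡 (2 * n)).tangent ∞
    (fun x => (⟨x, X x⟩ : TangentBundle (𝓡 (2 * n)) M)) U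

/-- The differential `df` at `x` of a real-valued function, as a linear form on `T_x M`. -/
def differential (f : M → ℝ) (x : M) : TangentSpace (𝓡 (2 * n)) x →L[ℝ] ℝ :=
  mfderiv (𝓡 (2 * n)) 𝓘(ℝ, ℝ) f x

/-- The derivative `X(f) = df(X)` of a function `f` along a vector field `X`. -/
def lieDeriv (X : ∀ x : M, TangentSpace (𝓡 (2 * n)) x) (f : M → ℝ) (x : M) : ℝ :=
  differential f x (X x)

variable (n M) in
/-- A smooth symplectic form on a smooth `2n`-manifold: a smooth, alternating, nondegenerate
and closed `2`-form. Closedness is the vanishing of `dω(X, Y, Z)` for all smooth vector fields,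
with `dω` written out by the invariant formula. -/
structure SymplecticForm where
  form : ∀ x : M, TangentSpace (𝓡 (2 * n)) x →L[ℝ] TangentSpace (𝓡 (2 * n)) x →L[ℝ] ℝ
  smooth : ContMDiff (𝓡 (2 * n))
    ((𝓡 (2 * n)).prod 𝓘(ℝ, EuclideanSpace ℝ (Fin (2 * n)) →L[ℝ]
      EuclideanSpace ℝ (Fin (2 * n)) →L[ℝ] ℝ)) ∞
    (fun x => Bundle.TotalSpace.mk' (EuclideanSpace ℝ (Fin (2 * n)) →L[ℝ]
      EuclideanSpace ℝ (Fin (2 * n)) →L[ℝ] ℝ)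
      (E := fun x : M => TangentSpace (𝓡 (2 * n)) x →L[ℝ] TangentSpace (𝓡 (2 * n)) x →L[ℝ] ℝ)
      x (form x))
  alternating : ∀ x v, form x v v = 0
  nondegenerate : ∀ x v, (∀ w, form x v w = 0) → v = 0
  closed : ∀ X Y Z : (∀ x : M, TangentSpace (𝓡 (2 * n)) x),
    IsSmoothFieldOn X Set.univ → IsSmoothFieldOn Y Set.univ → IsSmoothFieldOn Z Set.univ →
    ∀ x,
      lieDeriv X (fun y => form y (Y y) (Z y)) x
      + lieDeriv Y (fun y => form y (Z y) (X y)) x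
      + lieDeriv Z (fun y => form y (X y) (Y y)) x
      - form x (VectorField.mlieBracket (𝓡 (2 * n)) X Y x) (Z x)
      - form x (VectorField.mlieBracket (𝓡 (2 * n)) Y Z x) (X x)
      - form x (VectorField.mlieBracket (𝓡 (2 * n)) Z X x) (Y x) = 0

instance finiteDimensionalTangent (x : M) :
    FiniteDimensional ℝ (TangentSpace (𝓡 (2 * n)) x) :=
  inferInstanceAs (FiniteDimensional ℝ (EuclideanSpace ℝ (Fin (2 * n))))

namespace SymplecticForm

/-- The form at the point `x` as an algebraic bilinear form. -/
def bilin (Ω : SymplecticForm n M) (x : M) :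
    LinearMap.BilinForm ℝ (TangentSpace (𝓡 (2 * n)) x) :=
  LinearMap.mk₂ ℝ (fun v w => Ω.form x v w) (by intros; simp) (by intros; simp)
    (by intros; simp) (by intros; simp)

theorem bilin_apply (Ω : SymplecticForm n M) (x : M) (v w : TangentSpace (𝓡 (2 * n)) x) :
    Ω.bilin x v w = Ω.form x v w := rfl

theorem bilin_isAlt (Ω : SymplecticForm n M) (x : M) : (Ω.bilin x).IsAlt :=
  fun v => Ω.alternating x v

theorem bilin_nondegenerate (Ω : SymplecticForm n M) (x : M) : (Ω.bilin x).Nondegenerate := by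
  refine ⟨fun v hv => Ω.nondegenerate x v hv, fun v hv => Ω.nondegenerate x v fun w => ?_⟩
  exact (Ω.bilin_isAlt x).isRefl _ _ (hv w)

end SymplecticForm

/-- The Hamiltonian vector field `X_H`, the unique solution of `i_{X_H} ω = -dH`. -/
def hamiltonianField (Ω : SymplecticForm n M) (H : M → ℝ) (x : M) :
    TangentSpace (𝓡 (2 * n)) x :=
  ((Ω.bilin x).toDual (Ω.bilin_nondegenerate x)).symm
    (-(differential H x).toLinearMap)

theorem form_hamiltonianField (Ω : SymplecticForm n M) (H : M → ℝ) (x : M)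
    (w : TangentSpace (𝓡 (2 * n)) x) :
    Ω.form x (hamiltonianField Ω H x) w = -differential H x w :=
  LinearMap.BilinForm.apply_toDual_symm_apply (hB := Ω.bilin_nondegenerate x)
    (-(differential H x).toLinearMap) w

/-- A smooth symplectic distribution of rank `2k`: a family of `2k`-dimensional subspaces
`V_x ⊆ T_x M` on each of which the symplectic form is nondegenerate, and which near every point
is spanned by `2k` smooth vector fields. No integrability is required. -/
structure SymplecticDistribution (Ω : SymplecticForm n M) (k : ℕ) where
  fiber : ∀ x : M, Submodule ℝ (TangentSpace (𝓡 (2 * n)) x)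
  finrank_fiber : ∀ x, Module.finrank ℝ (fiber x) = 2 * k
  smooth : ∀ x₀ : M, ∃ (U : Set M) (Y : Fin (2 * k) → ∀ x : M, TangentSpace (𝓡 (2 * n)) x),
    IsOpen U ∧ x₀ ∈ U ∧ (∀ i, IsSmoothFieldOn (Y i) U) ∧
    ∀ x ∈ U, Submodule.span ℝ (Set.range fun i => Y i x) = fiber x
  symplectic : ∀ x, ∀ v ∈ fiber x, (∀ w ∈ fiber x, Ω.form x v w = 0) → v = 0

variable {Ω : SymplecticForm n M} {k : ℕ}

namespace SymplecticDistribution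

/-- The fibre at `x` of the symplectic complement `V^⊥`. -/
def complement (V : SymplecticDistribution Ω k) (x : M) :
    Submodule ℝ (TangentSpace (𝓡 (2 * n)) x) :=
  (Ω.bilin x).orthogonal (V.fiber x)

theorem isCompl (V : SymplecticDistribution Ω k) (x : M) :
    IsCompl (V.fiber x) (V.complement x) := by
  refine (LinearMap.BilinForm.isCompl_orthogonal_iff_disjoint (Ω.bilin_isAlt x).isRefl).2 ?_
  refine Submodule.disjoint_def.2 fun v hv hv' => V.symplectic x v hv fun w hw => ?_
  exact (Ω.bilin_isAlt x).isRefl _ _ (hv' w hw)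

/-- The `ω`-skew orthogonal projection `π_V` of `T_x M` onto `V_x`, with kernel `V_x^⊥`. -/
def proj (V : SymplecticDistribution Ω k) (x : M) :
    TangentSpace (𝓡 (2 * n)) x →ₗ[ℝ] TangentSpace (𝓡 (2 * n)) x :=
  Submodule.projection (V.fiber x) (V.complement x) (V.isCompl x)

/-- The vector field `X_H^V = π_V(X_H)` of the constrained Hamiltonian system. -/
def constrainedField (V : SymplecticDistribution Ω k) (H : M → ℝ) (x : M) :
    TangentSpace (𝓡 (2 * n)) x :=
  V.proj x (hamiltonianField Ω H x)

/-- The critical set of the constrained Hamiltonian system. -/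
def criticalSet (V : SymplecticDistribution Ω k) (H : M → ℝ) : Set M :=
  {x | V.constrainedField H x = 0}

/-- `Y_1, …, Y_{2k}` is a smooth local spanning family of `V` over the open set `U`. -/
structure IsSpanningFamilyOn (V : SymplecticDistribution Ω k)
    (Y : Fin (2 * k) → ∀ x : M, TangentSpace (𝓡 (2 * n)) x) (U : Set M) : Prop where
  isOpen : IsOpen U
  smooth : ∀ i, IsSmoothFieldOn (Y i) U
  span_eq : ∀ x ∈ U, Submodule.span ℝ (Set.range fun i => Y i x) = V.fiber x

end SymplecticDistribution

/-- The map `F = (Y_1(H), …, Y_{2k}(H))`. -/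
def frameMap (Y : Fin (2 * k) → ∀ x : M, TangentSpace (𝓡 (2 * n)) x) (H : M → ℝ) (x : M) :
    EuclideanSpace ℝ (Fin (2 * k)) :=
  WithLp.toLp 2 fun i => lieDeriv (Y i) H x

/-- The differential of `F : M → ℝ^m` at `x` is surjective. -/
def IsRegularAt {m : ℕ} (F : M → EuclideanSpace ℝ (Fin m)) (x : M) : Prop :=
  Function.Surjective (mfderiv (𝓡 (2 * n)) (𝓡 m) F x)

/-- `c` is a regular value of the restriction of `F` to the open set `U`. -/
def IsRegularValueOn {m : ℕ} (F : M → EuclideanSpace ℝ (Fin m)) (U : Set M)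
    (c : EuclideanSpace ℝ (Fin m)) : Prop :=
  ∀ x ∈ U, F x = c → IsRegularAt (n := n) F x

/-- `S` is a smooth embedded `d`-dimensional submanifold of the `2n`-manifold `M`: near each of its
points there is a chart of the smooth structure in which `S` is the slice on which all
coordinates but the first `d` vanish. The empty set counts as a submanifold. -/
def IsSmoothSubmanifold (d : ℕ) (S : Set M) : Prop :=
  d ≤ 2 * n ∧ ∀ p ∈ S, ∃ e ∈ IsManifold.maximalAtlas (𝓡 (2 * n)) ∞ M, p ∈ e.source ∧
    ∀ q ∈ e.source, q ∈ S ↔ ∀ i : Fin (2 * n), d ≤ (i : ℕ) → e q i = 0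

namespace SymplecticDistribution

/-- The genericity condition on the constrained Hamiltonian system: `0` is a regular value of
`F = (Y_1(H), …, Y_{2k}(H))` for every local spanning family of `V`. -/
def IsGeneric (V : SymplecticDistribution Ω k) (H : M → ℝ) : Prop :=
  ∀ Y U, V.IsSpanningFamilyOn Y U → IsRegularValueOn (n := n) (frameMap Y H) U 0

/-- The generic part of the critical set: those critical points near which, for some local
spanning family, `F` has surjective differential at the point. -/
def genericCriticalSet (V : SymplecticDistribution Ω k) (H : M → ℝ) : Set M :=
  {x | x ∈ V.criticalSet H ∧
    ∃ Y U, V.IsSpanningFamilyOn Y U ∧ x ∈ U ∧ IsRegularAt (n := n) (frameMap Y H) x}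

end SymplecticDistribution

end

end ConstrainedHamiltonian

end

/-!
The set `C` is locally the zero set of the components `F = (Y_1(H), …, Y_{2k}(H))` of `dH` along a
frame of `V`: the equation `π_V(X_H) = 0` says that `X_H` is `ω`-orthogonal to `V`, that is, that
`dH = -ω(X_H, ·)` vanishes on `V` (`mem_criticalSet_iff`). The rest is
differential topology of `F`.

Regular level sets are submanifolds by the inverse function theorem (`exists_straightening`,
`exists_slice_chart`). That almost every value is regular is Sard's theorem
(`measure_image_critical_eq_zero`), proved by induction on the dimension of the source. The critical
set is split into three parts. Where the derivative does not vanish, Fubini's theorem over the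
level sets of one component of the map reduces to a lower dimension. Where some derivative of order
`k + 1 ≥ 2` is the first that does not vanish, the points lie on a hypersurface given by a
derivative of order `k`, all of whose points in question are critical for the restriction. Where all
derivatives up to the dimension of the source vanish, the map is Hölder of such a high exponent that
the image has Hausdorff dimension less than one.

Two frames of `V` differ by locally bounded matrices, so that the corresponding maps `F`, `F'`
satisfy `F = O(F')` and `F' = O(F)`. At a common zero their differentials then have the same kernel,
and one is onto if and only if the other is (`surjective_fderiv_of_isBigO`). Hence genericity can be
tested on one frame near each point (`isGeneric_iff`).

For the family `H + ∑ t_j f_j` the map `F` depends affinely on `t`, with linear part `A(x)` onto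
since the `df_j` span the dual of `V_x`. Restricting `t` to translates of a `2k`-dimensional space
on which `A(x)` is invertible, the equation `F = 0` can be solved for the parameter, `s = G(x)`, and
zero is a regular value if and only if `s` is a regular value of `G`. Sard's theorem for `G`
and Fubini's theorem over the translates give the result (`ae_surjective_fderiv_of_surjective`).
-/

namespace ConstrainedHamiltonian

open scoped Topology

open MeasureTheory

/-! ### Straightening a submersion -/

section Straightening

variable {E F : Type*} [NormedAddCommGroup E] [NormedSpace ℝ E]
  [NormedAddCommGroup F] [NormedSpace ℝ F]

theorem isOpen_setOf_surjective [FiniteDimensional ℝ F] :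
    IsOpen {A : E →L[ℝ] F | Function.Surjective A} := by
  have : CompleteSpace F := FiniteDimensional.complete ℝ F
  refine isOpen_iff_mem_nhds.2 fun A hA => ?_
  obtain ⟨B, hB⟩ := A.exists_rightInverse_of_surjective (LinearMap.range_eq_top.2 hA)
  -- Near `A` the composition with a fixed right inverse of `A` stays invertible.
  have hopen : IsOpen ((fun A' : E →L[ℝ] F => A'.comp B) ⁻¹'
      Set.range ((↑) : (F ≃L[ℝ] F) → F →L[ℝ] F)) :=
    ContinuousLinearEquiv.isOpen.preimage (by fun_prop)
  refine Filter.mem_of_superset (hopen.mem_nhds ⟨.refl ℝ F, hB.symm⟩) ?_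
  rintro A' ⟨L, hL⟩ y
  refine ⟨B (L.symm y), ?_⟩
  have := congrArg (fun T : F →L[ℝ] F => T (L.symm y)) hL
  simpa using this.symm

theorem surjective_of_ne_zero {A : E →L[ℝ] ℝ} (hA : A ≠ 0) : Function.Surjective A :=
  (A : E →ₗ[ℝ] ℝ).surjective fun h => hA (ContinuousLinearMap.coe_injective h)

/-- A surjective linear map is the first component of a linear isomorphism onto the product of its
target and its kernel. -/
theorem exists_equiv_prod_ker [FiniteDimensional ℝ F] (A : E →L[ℝ] F) (hA : Function.Surjective A) :
    ∃ (Q : E →L[ℝ] A.ker) (L : E ≃L[ℝ] F × A.ker), (L : E →L[ℝ] F × A.ker) = A.prod Q := by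
  obtain ⟨B, hB⟩ := A.exists_rightInverse_of_surjective (LinearMap.range_eq_top.2 hA)
  have hB' (y : F) : A (B y) = y := congrArg (fun T : F →L[ℝ] F => T y) hB
  let Q : E →L[ℝ] A.ker :=
    (ContinuousLinearMap.id ℝ E - B.comp A).codRestrict A.ker fun x => by simp [hB']
  have hQ (x : E) : (Q x : E) = x - B (A x) := rfl
  refine ⟨Q, ContinuousLinearEquiv.equivOfInverse (A.prod Q) (B.coprod A.ker.subtypeL)
    (fun x => ?_) (fun p => ?_), ?_⟩
  · simp [hQ]
  · have h2 : A p.2 = 0 := p.2.2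
    ext
    · simp [hB', h2]
    · simp [hQ, hB', h2]
  · ext x <;> rfl

/-- The inverse function theorem for smooth maps, with an inverse that is smooth on the whole target
of the local homeomorphism and not only at the image of the given point. -/
theorem exists_openPartialHomeomorph_of_fderiv_eq [FiniteDimensional ℝ E] {ψ : E → F}
    {W : Set E} (hW : IsOpen W)
    (hψ : ContDiffOn ℝ ∞ ψ W) {x : E} (hx : x ∈ W) (L : E ≃L[ℝ] F)
    (hL : fderiv ℝ ψ x = (L : E →L[ℝ] F)) :
    ∃ e : OpenPartialHomeomorph E F, x ∈ e.source ∧ e.source ⊆ W ∧ (∀ y, e y = ψ y) ∧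
      ContDiffOn ℝ ∞ e.symm e.target := by
  have : CompleteSpace E := FiniteDimensional.complete ℝ E
  have hat (y : E) (hy : y ∈ W) : ContDiffAt ℝ ∞ ψ y := hψ.contDiffAt (hW.mem_nhds hy)
  have hder : HasFDerivAt ψ (L : E →L[ℝ] F) x :=
    hL ▸ ((hat x hx).differentiableAt (by simp)).hasFDerivAt
  let e₀ := (hat x hx).toOpenPartialHomeomorph ψ hder (by simp)
  -- The inverse is smooth where the derivative stays invertible, which is an open condition.
  let V : Set E := W ∩ fderiv ℝ ψ ⁻¹' Set.range ((↑) : (E ≃L[ℝ] F) → E →L[ℝ] F)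
  have hV : IsOpen V :=
    (hψ.continuousOn_fderiv_of_isOpen hW (by simp)).isOpen_inter_preimage hW
      ContinuousLinearEquiv.isOpen
  refine ⟨e₀.restrOpen V hV, ⟨(hat x hx).mem_toOpenPartialHomeomorph_source hder (by simp),
    hx, L, hL.symm⟩, fun y hy => hy.2.1, fun y => rfl, fun z hz => ?_⟩
  obtain ⟨hyW, L', hL'⟩ := ((e₀.restrOpen V hV).map_target hz).2
  refine ((e₀.restrOpen V hV).contDiffAt_symm (f₀' := L') hz ?_ (hat _ hyW)).contDiffWithinAt
  rw [hL']
  exact ((hat _ hyW).differentiableAt (by simp)).hasFDerivAt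

/-- Near a point where the derivative of `ρ` is onto, `ρ` is the first component of a system of
smooth coordinates. -/
theorem exists_straightening [FiniteDimensional ℝ E] [FiniteDimensional ℝ F]
    {ρ : E → F} {W : Set E} (hW : IsOpen W)
    (hρ : ContDiffOn ℝ ∞ ρ W) {x : E} (hx : x ∈ W) (hs : Function.Surjective (fderiv ℝ ρ x)) :
    ∃ e : OpenPartialHomeomorph E (F × (fderiv ℝ ρ x).ker), x ∈ e.source ∧ e.source ⊆ W ∧
      (∀ y, (e y).1 = ρ y) ∧ ContDiffOn ℝ ∞ e e.source ∧ ContDiffOn ℝ ∞ e.symm e.target := by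
  obtain ⟨Q, L, hL⟩ := exists_equiv_prod_ker (fderiv ℝ ρ x) hs
  have hψ : ContDiffOn ℝ ∞ (fun y => (ρ y, Q y)) W := hρ.prodMk Q.contDiff.contDiffOn
  have hd : DifferentiableAt ℝ ρ x :=
    (hρ.contDiffAt (hW.mem_nhds hx)).differentiableAt (by simp)
  obtain ⟨e, hxe, heW, he, hsymm⟩ := exists_openPartialHomeomorph_of_fderiv_eq hW hψ hx L (by
    rw [hL]
    exact (hd.hasFDerivAt.prodMk Q.hasFDerivAt).fderiv)
  exact ⟨e, hxe, heW, fun y => by rw [he], (hψ.mono heW).congr fun y _ => he y, hsymm⟩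

theorem finrank_ker_add [FiniteDimensional ℝ E] {A : E →L[ℝ] F} (hA : Function.Surjective A) :
    Module.finrank ℝ F + Module.finrank ℝ A.ker = Module.finrank ℝ E := by
  have h1 := (A : E →ₗ[ℝ] F).finrank_range_add_finrank_ker
  rw [LinearMap.range_eq_top.2 (show Function.Surjective (A : E →ₗ[ℝ] F) from hA),
    finrank_top] at h1
  exact h1

end Straightening

/-! ### Sard's theorem -/

section Sard

universe u

variable {E F : Type u} [NormedAddCommGroup E] [NormedSpace ℝ E]
  [NormedAddCommGroup F] [NormedSpace ℝ F]

/-- The sets with null image form a `σ`-ideal, so that nullity of the image is a local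
property. -/
theorem measure_image_null_of_locally_null {X Y : Type*} [TopologicalSpace X]
    [SecondCountableTopology X] [MeasurableSpace Y] (μ : Measure Y) (f : X → Y) (s : Set X)
    (h : ∀ x ∈ s, ∃ u ∈ 𝓝[s] x, μ (f '' u) = 0) : μ (f '' s) = 0 := by
  have := measure_null_of_locally_null (μ := OuterMeasure.comap f μ.toOuterMeasure) s
    (fun x hx => by
      obtain ⟨u, hu, h0⟩ := h x hx
      exact ⟨u, hu, by simpa [OuterMeasure.comap_apply] using h0⟩)
  simpa [OuterMeasure.comap_apply] using this

/-- Taylor's estimate at a point where the derivatives of orders `1, …, n` vanish. -/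
theorem norm_sub_le_of_iteratedFDeriv_eq_zero {f : E → F} {s : Set E} (hs : IsOpen s)
    (hf : ContDiffOn ℝ ∞ f s) {x : E} {r M : ℝ} (hball : Metric.ball x r ⊆ s) {n : ℕ}
    (hM : ∀ y ∈ Metric.ball x r, ‖iteratedFDeriv ℝ (n + 1) f y‖ ≤ M)
    (hx : ∀ i, 1 ≤ i → i ≤ n → iteratedFDeriv ℝ i f x = 0) {y : E} (hy : y ∈ Metric.ball x r) :
    ‖f y - f x‖ ≤ M * ‖y - x‖ ^ (n + 1) := by
  have hr : 0 < r := Metric.pos_of_mem_ball hy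
  have hM0 : 0 ≤ M := (norm_nonneg _).trans (hM x (Metric.mem_ball_self hr))
  -- Integrating a bound on the derivative of order `i + 1` over the segment from `x`.
  have step (i a : ℕ) (h : ∀ y ∈ Metric.ball x r,
      ‖iteratedFDeriv ℝ (i + 1) f y‖ ≤ M * ‖y - x‖ ^ a) {y : E} (hy : y ∈ Metric.ball x r) :
      ‖iteratedFDeriv ℝ i f y - iteratedFDeriv ℝ i f x‖ ≤ M * ‖y - x‖ ^ (a + 1) := by
    have hsub (z : E) (hz : z ∈ Metric.closedBall x ‖y - x‖) : z ∈ Metric.ball x r := by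
      rw [mem_ball_iff_norm] at hy
      exact Metric.closedBall_subset_ball hy hz
    rw [pow_succ, ← mul_assoc]
    refine (convex_closedBall x ‖y - x‖).norm_image_sub_le_of_norm_fderiv_le (𝕜 := ℝ)
      (fun z hz => ?_) (fun z hz => ?_) (Metric.mem_closedBall_self (norm_nonneg _))
      (mem_closedBall_iff_norm.2 le_rfl)
    · have hz' := hball (hsub z hz)
      exact (hf.contDiffAt (hs.mem_nhds hz')).differentiableAt_iteratedFDeriv
        (by exact_mod_cast WithTop.coe_lt_top _)
    · rw [norm_fderiv_iteratedFDeriv]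
      refine (h z (hsub z hz)).trans ?_
      rw [mem_closedBall_iff_norm] at hz
      gcongr
  have key (a : ℕ) (ha : a ≤ n) : ∀ y ∈ Metric.ball x r,
      ‖iteratedFDeriv ℝ (n + 1 - a) f y‖ ≤ M * ‖y - x‖ ^ a := by
    induction a with
    | zero => simpa using hM
    | succ a ih =>
      intro y hy
      have e1 : n + 1 - a = (n + 1 - (a + 1)) + 1 := by omega
      have := step (n + 1 - (a + 1)) a (fun z hz => e1 ▸ ih (by omega) z hz) hy
      rwa [hx _ (by omega) (by omega), sub_zero] at this
  have e2 : n + 1 - n = 0 + 1 := by omega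
  have := step 0 n (fun z hz => e2 ▸ key n le_rfl z hz) hy
  have e0 : iteratedFDeriv ℝ 0 f y - iteratedFDeriv ℝ 0 f x =
      (continuousMultilinearCurryFin0 ℝ E F).symm (f y - f x) := by
    rw [map_sub]
    rfl
  rwa [e0, LinearIsometryEquiv.norm_map] at this

variable [FiniteDimensional ℝ E] [FiniteDimensional ℝ F] [MeasurableSpace F] [BorelSpace F]

/-- The image of the set where all derivatives up to the order `n = dim E` vanish is null: there
`f` is locally Hölder of exponent `n + 1`, so that the image has Hausdorff dimension at most
`n / (n + 1) < 1`. -/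
theorem measure_image_flat_eq_zero [Nontrivial F] (μ : Measure F) [μ.IsAddHaarMeasure]
    {f : E → F} {U : Set E} (hU : IsOpen U) (hf : ContDiffOn ℝ ∞ f U) :
    μ (f '' {x ∈ U | ∀ i, 1 ≤ i → i ≤ Module.finrank ℝ E → iteratedFDeriv ℝ i f x = 0}) = 0 := by
  set n := Module.finrank ℝ E with hn
  set S := {x ∈ U | ∀ i, 1 ≤ i → i ≤ n → iteratedFDeriv ℝ i f x = 0} with hS
  have hdim : dimH (f '' S) ≤ dimH S / ((n + 1 : ℕ) : NNReal) := by
    refine dimH_image_le_of_locally_holder_on (by positivity) fun x hx => ?_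
    have hcont : ContinuousAt (iteratedFDeriv ℝ (n + 1) f) x :=
      ((hf.contDiffAt (hU.mem_nhds hx.1)).differentiableAt_iteratedFDeriv
        (by exact_mod_cast WithTop.coe_lt_top _)).continuousAt
    set M : ℝ := ‖iteratedFDeriv ℝ (n + 1) f x‖ + 1 with hM
    have hev : ∀ᶠ y in 𝓝 x, y ∈ U ∧ ‖iteratedFDeriv ℝ (n + 1) f y‖ < M :=
      (hU.eventually_mem hx.1).and
        (hcont.norm.eventually_lt continuousAt_const (by simp [hM]))
    obtain ⟨r, hr, hball⟩ := Metric.eventually_nhds_iff_ball.1 hev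
    have hM0 : 0 ≤ M := by positivity
    refine ⟨M.toNNReal, S ∩ Metric.ball x (r / 3),
      inter_mem_nhdsWithin _ (Metric.ball_mem_nhds x (by positivity)), ?_⟩
    rintro y ⟨hyS, hy⟩ z ⟨hzS, hz⟩
    rw [Metric.mem_ball] at hy hz
    have hsub : Metric.ball z (2 * r / 3) ⊆ Metric.ball x r :=
      Metric.ball_subset_ball' (by linarith)
    have hyz : y ∈ Metric.ball z (2 * r / 3) := by
      rw [Metric.mem_ball]
      linarith [dist_triangle_right y z x]
    have hb : ‖f y - f z‖ ≤ M * ‖y - z‖ ^ (n + 1) :=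
      norm_sub_le_of_iteratedFDeriv_eq_zero hU hf (fun w hw => (hball w (hsub hw)).1)
        (fun w hw => (hball w (hsub hw)).2.le) hzS.2 hyz
    rw [edist_dist, edist_dist, dist_eq_norm, dist_eq_norm]
    have : ENNReal.ofReal ‖f y - f z‖ ≤ ENNReal.ofReal (M * ‖y - z‖ ^ (n + 1)) :=
      ENNReal.ofReal_le_ofReal hb
    rw [ENNReal.ofReal_mul hM0, ENNReal.ofReal_pow (norm_nonneg _)] at this
    refine this.trans (le_of_eq ?_)
    congr 1
    rw [← ENNReal.rpow_natCast]
    simp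
  have hlt : dimH (f '' S) < ((Module.finrank ℝ F : NNReal) : ENNReal) := by
    have hS : dimH S ≤ n := by
      rw [hn, ← Real.dimH_univ_eq_finrank E]
      exact dimH_mono (Set.subset_univ S)
    have hF : ((1 : ℕ) : ENNReal) ≤ ((Module.finrank ℝ F : NNReal) : ENNReal) := by
      exact_mod_cast Nat.succ_le_of_lt (Module.finrank_pos (R := ℝ) (M := F))
    refine (hdim.trans (ENNReal.div_le_div_right hS _)).trans_lt (lt_of_lt_of_le ?_ hF)
    refine ENNReal.div_lt_of_lt_mul' ?_
    push_cast
    rw [mul_one]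
    exact_mod_cast Nat.lt_succ_self n
  have h0 := hausdorffMeasure_of_dimH_lt hlt
  have : (Measure.hausdorffMeasure (Module.finrank ℝ F : ℝ) : Measure F).IsAddHaarMeasure :=
    isAddHaarMeasure_hausdorffMeasure
  exact Measure.absolutelyContinuous_isAddHaarMeasure μ
    (Measure.hausdorffMeasure (Module.finrank ℝ F : ℝ)) (by simpa using h0)

/-- Sard's theorem for maps on spaces of dimension less than `d`: the induction hypothesis. -/
def SardBelow (d : ℕ) : Prop :=
  ∀ (E F : Type u) [NormedAddCommGroup E] [NormedSpace ℝ E] [FiniteDimensional ℝ E]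
    [NormedAddCommGroup F] [NormedSpace ℝ F] [FiniteDimensional ℝ F] [MeasurableSpace F]
    [BorelSpace F] (μ : Measure F) [μ.IsAddHaarMeasure] (f : E → F) (U : Set E),
    Module.finrank ℝ E < d → IsOpen U → ContDiffOn ℝ ∞ f U →
    μ (f '' {x ∈ U | ¬ Function.Surjective (fderiv ℝ f x)}) = 0

/-- The points where the derivatives of orders `1` and `k` vanish but that of order `k + 1` does
not lie on a hypersurface, and are critical for the restriction of `f` to it. -/
theorem exists_nhds_measure_image_eq_zero_of_iteratedFDeriv_ne_zero [Nontrivial F]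
    (ih : SardBelow.{u} (Module.finrank ℝ E)) (μ : Measure F) [μ.IsAddHaarMeasure]
    {f : E → F} {U : Set E} (hU : IsOpen U) (hf : ContDiffOn ℝ ∞ f U) {k : ℕ} {x : E}
    (hx : x ∈ U) (hk : iteratedFDeriv ℝ (k + 1) f x ≠ 0) :
    ∃ W ∈ 𝓝 x, μ (f '' {y ∈ W | fderiv ℝ f y = 0 ∧ iteratedFDeriv ℝ k f y = 0}) = 0 := by
  have hsmooth : ContDiffOn ℝ ∞ (iteratedFDeriv ℝ k f) U := fun y hy =>
    ((hf.contDiffAt (hU.mem_nhds hy)).iteratedFDeriv_right (m := ∞)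
      (by exact_mod_cast le_top)).contDiffWithinAt
  have hdiff : DifferentiableAt ℝ (iteratedFDeriv ℝ k f) x :=
    (hsmooth.contDiffAt (hU.mem_nhds hx)).differentiableAt (by simp)
  have hne : fderiv ℝ (iteratedFDeriv ℝ k f) x ≠ 0 := fun h0 => hk <| by
    rw [← norm_eq_zero, ← norm_fderiv_iteratedFDeriv, h0]
    exact norm_zero (E := E →L[ℝ] E [×k]→L[ℝ] F)
  obtain ⟨v, hv⟩ := DFunLike.ne_iff.1 hne
  obtain ⟨l, hl⟩ := SeparatingDual.exists_ne_zero (R := ℝ) hv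
  have hρ : ContDiffOn ℝ ∞ (fun y => l (iteratedFDeriv ℝ k f y)) U :=
    l.contDiff.comp_contDiffOn hsmooth
  have hρ' : fderiv ℝ (fun y => l (iteratedFDeriv ℝ k f y)) x =
      l.comp (fderiv ℝ (iteratedFDeriv ℝ k f) x) :=
    (l.hasFDerivAt.comp x hdiff.hasFDerivAt).fderiv
  have hs : Function.Surjective (fderiv ℝ (fun y => l (iteratedFDeriv ℝ k f y)) x) :=
    surjective_of_ne_zero fun h0 => hl (by
      have := congrArg (fun T : E →L[ℝ] ℝ => T v) h0
      simpa [hρ'] using this)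
  obtain ⟨e, hxe, heU, he1, -, hes⟩ := exists_straightening hU hρ hx hs
  have hfin := finrank_ker_add hs
  rw [Module.finrank_self] at hfin
  let V : Set (fderiv ℝ (fun y => l (iteratedFDeriv ℝ k f y)) x).ker :=
    (fun w => ((0 : ℝ), w)) ⁻¹' e.target
  have hV : IsOpen V := e.open_target.preimage (by fun_prop)
  have hι : ContDiffOn ℝ ∞ (fun w => e.symm ((0 : ℝ), w)) V :=
    hes.comp (contDiff_const.prodMk contDiff_id).contDiffOn fun w hw => hw
  have hg : ContDiffOn ℝ ∞ (fun w => f (e.symm ((0 : ℝ), w))) V :=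
    hf.comp hι fun w hw => heU (e.map_target hw)
  refine ⟨e.source, e.open_source.mem_nhds hxe,
    measure_mono_null ?_ (ih _ F μ _ V (by omega) hV hg)⟩
  rintro _ ⟨y, ⟨hy, hy1, hyk⟩, rfl⟩
  have hey : e y = (0, (e y).2) := Prod.ext (by rw [he1, hyk, map_zero]) rfl
  have hsy : e.symm (0, (e y).2) = y := by rw [← hey, e.left_inv hy]
  have hyV : (e y).2 ∈ V := by
    change ((0 : ℝ), (e y).2) ∈ e.target
    rw [← hey]
    exact e.map_source hy
  refine ⟨(e y).2, ⟨hyV, fun hsurj => ?_⟩, by simp only [hsy]⟩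
  have hdf : DifferentiableAt ℝ f (e.symm (0, (e y).2)) := by
    rw [hsy]
    exact (hf.contDiffAt (hU.mem_nhds (heU hy))).differentiableAt (by simp)
  have hcomp := fderiv_comp (e y).2 hdf
    ((hι.contDiffAt (hV.mem_nhds hyV)).differentiableAt (by simp))
  rw [hsy, hy1, ContinuousLinearMap.zero_comp] at hcomp
  obtain ⟨z, hz⟩ := exists_ne (0 : F)
  obtain ⟨w, hw⟩ := hsurj z
  have : fderiv ℝ (fun w => f (e.symm ((0 : ℝ), w))) (e y).2 = 0 := hcomp
  rw [this] at hw
  exact hz hw.symm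

/-- Where the derivative does not vanish, some linear form `l` makes `l ∘ f` a coordinate; the
restrictions of `f` to the level sets of `l ∘ f` are maps between spaces of one dimension less,
and Fubini's theorem applies to the hyperplanes `l = t`. -/
theorem exists_nhds_measure_image_eq_zero_of_fderiv_ne_zero
    (ih : SardBelow.{u} (Module.finrank ℝ E)) (μ : Measure F) [μ.IsAddHaarMeasure]
    {f : E → F} {U : Set E} (hU : IsOpen U) (hf : ContDiffOn ℝ ∞ f U) {x : E}
    (hx : x ∈ U) (hne : fderiv ℝ f x ≠ 0) :
    ∃ W ∈ 𝓝 x, μ (f '' {y ∈ W | ¬ Function.Surjective (fderiv ℝ f y)}) = 0 := by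
  have hdiff (y : E) (hy : y ∈ U) : DifferentiableAt ℝ f y :=
    (hf.contDiffAt (hU.mem_nhds hy)).differentiableAt (by simp)
  obtain ⟨v, hv⟩ := DFunLike.ne_iff.1 hne
  obtain ⟨l, hl⟩ := SeparatingDual.exists_ne_zero (R := ℝ) hv
  have hρ : ContDiffOn ℝ ∞ (fun y => l (f y)) U := l.contDiff.comp_contDiffOn hf
  have hρ' (y : E) (hy : y ∈ U) : fderiv ℝ (fun y => l (f y)) y = l.comp (fderiv ℝ f y) :=
    (l.hasFDerivAt.comp y (hdiff y hy).hasFDerivAt).fderiv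
  have hs : Function.Surjective (fderiv ℝ (fun y => l (f y)) x) :=
    surjective_of_ne_zero fun h0 => hl (by
      have := congrArg (fun T : E →L[ℝ] ℝ => T v) h0
      simpa [hρ' x hx] using this)
  obtain ⟨e, hxe, heU, he1, -, hes⟩ := exists_straightening hU hρ hx hs
  have hfin := finrank_ker_add hs
  rw [Module.finrank_self] at hfin
  have hlsurj : Function.Surjective l := surjective_of_ne_zero fun h => hl (by simp [h])
  obtain ⟨Q, hQ⟩ : ∃ Q : F →L[ℝ] l.ker, ∀ z : l.ker, Q z = z := by
    obtain ⟨u, hu⟩ := hlsurj 1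
    refine ⟨(ContinuousLinearMap.id ℝ F - l.smulRight u).codRestrict l.ker
      fun z => by simp [hu], fun z => ?_⟩
    ext
    have hz : l z = 0 := z.2
    simp [hz]
  obtain ⟨N, hN, hNe, hNc⟩ := local_compact_nhds (e.open_source.mem_nhds hxe)
  refine ⟨N, hN, ?_⟩
  set S : Set F := f '' {y ∈ N | ¬ Function.Surjective (fderiv ℝ f y)} with hS
  have hSc : IsCompact S := by
    have hcont : ContinuousOn (fderiv ℝ f) N :=
      (hf.continuousOn_fderiv_of_isOpen hU (by simp)).mono (hNe.trans heU)
    have hclosed : IsClosed (N ∩ fderiv ℝ f ⁻¹' {A | Function.Surjective A}ᶜ) :=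
      hcont.preimage_isClosed_of_isClosed hNc.isClosed isOpen_setOf_surjective.isClosed_compl
    exact (hNc.of_isClosed_subset hclosed Set.inter_subset_left).image_of_continuousOn
      (hf.continuousOn.mono (Set.inter_subset_left.trans (hNe.trans heU)))
  suffices h : ∀ᵐ z ∂μ, z ∈ Sᶜ by simpa [ae_iff] using h
  refine ae_mem_of_ae_add_linearMap_mem l.ker.subtype (Measure.addHaar : Measure l.ker) μ
    hSc.measurableSet.compl fun z₀ => ?_
  -- The slice of `f` over the hyperplane `l = l z₀`.
  let V : Set (fderiv ℝ (fun y => l (f y)) x).ker := (fun w => (l z₀, w)) ⁻¹' e.target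
  let ι : (fderiv ℝ (fun y => l (f y)) x).ker → E := fun w => e.symm (l z₀, w)
  have hV : IsOpen V := e.open_target.preimage (by fun_prop)
  have hι : ContDiffOn ℝ ∞ ι V :=
    hes.comp (contDiff_const.prodMk contDiff_id).contDiffOn fun w hw => hw
  have hg : ContDiffOn ℝ ∞ (fun w => Q (f (ι w) - z₀)) V :=
    Q.contDiff.comp_contDiffOn
      ((hf.comp hι fun w hw => heU (e.map_target hw)).sub contDiffOn_const)
  have hnull := ih _ _ (Measure.addHaar : Measure l.ker) _ V (by omega) hV hg
  rw [ae_iff]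
  refine measure_mono_null ?_ hnull
  intro z hz
  have hz' : z₀ + (z : F) ∈ S := by simpa using hz
  obtain ⟨y, ⟨hyN, hyc⟩, hfy⟩ := hz'
  have hy : y ∈ e.source := hNe hyN
  have hlz : l z = 0 := z.2
  have hey : e y = (l z₀, (e y).2) := Prod.ext (by rw [he1, hfy, map_add, hlz, add_zero]) rfl
  have hιy : ι (e y).2 = y := by
    change e.symm (l z₀, (e y).2) = y
    rw [← hey, e.left_inv hy]
  have hyV : (e y).2 ∈ V := by
    change (l z₀, (e y).2) ∈ e.target
    rw [← hey]
    exact e.map_source hy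
  refine ⟨(e y).2, ⟨hyV, fun hsurj => hyc ?_⟩, ?_⟩
  · have hιd : DifferentiableAt ℝ ι (e y).2 :=
      (hι.contDiffAt (hV.mem_nhds hyV)).differentiableAt (by simp)
    have hcomp : HasFDerivAt (fun w => f (ι w)) ((fderiv ℝ f y).comp (fderiv ℝ ι (e y).2))
        (e y).2 := by
      have h1 : HasFDerivAt f (fderiv ℝ f y) (ι (e y).2) := by
        rw [hιy]
        exact (hdiff y (heU hy)).hasFDerivAt
      exact h1.comp (e y).2 hιd.hasFDerivAt
    have hgd : fderiv ℝ (fun w => Q (f (ι w) - z₀)) (e y).2 =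
        Q.comp ((fderiv ℝ f y).comp (fderiv ℝ ι (e y).2)) :=
      (Q.hasFDerivAt.comp (e y).2 (hcomp.sub_const z₀)).fderiv
    -- `l ∘ f` is constant on the slice.
    have htan (w) : l (fderiv ℝ f y (fderiv ℝ ι (e y).2 w)) = 0 := by
      have hconst : (fun w => l (f (ι w))) =ᶠ[𝓝 (e y).2] fun _ => l z₀ := by
        filter_upwards [hV.mem_nhds hyV] with w hw
        rw [← he1]
        exact congrArg Prod.fst (e.right_inv hw)
      have h1 := (l.hasFDerivAt.comp (e y).2 hcomp).unique
        ((hasFDerivAt_const (l z₀) (e y).2).congr_of_eventuallyEq hconst)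
      exact congrArg (fun T => T w) h1
    -- A vector along which `l ∘ f` grows.
    have hlf : ∃ a, l (fderiv ℝ f y a) ≠ 0 := by
      by_contra! h0
      have hz1 : HasFDerivAt (fun p => l (f (e.symm p))) (ContinuousLinearMap.fst ℝ ℝ
          (fderiv ℝ (fun y => l (f y)) x).ker) (e y) := by
        refine hasFDerivAt_fst.congr_of_eventuallyEq ?_
        filter_upwards [e.open_target.mem_nhds (e.map_source hy)] with p hp
        rw [← he1]
        exact congrArg Prod.fst (e.right_inv hp)
      have hed : DifferentiableAt ℝ e.symm (e y) :=
        (hes.contDiffAt (e.open_target.mem_nhds (e.map_source hy))).differentiableAt (by simp)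
      have hz2 : HasFDerivAt (fun p => l (f (e.symm p)))
          (l.comp ((fderiv ℝ f y).comp (fderiv ℝ e.symm (e y)))) (e y) := by
        have h1 : HasFDerivAt f (fderiv ℝ f y) (e.symm (e y)) := by
          rw [e.left_inv hy]
          exact (hdiff y (heU hy)).hasFDerivAt
        exact l.hasFDerivAt.comp (e y) (h1.comp (e y) hed.hasFDerivAt)
      have h2 := congrArg (fun T => T ((1 : ℝ), 0)) (hz1.unique hz2)
      simp [h0] at h2
    obtain ⟨a, ha⟩ := hlf
    intro b
    obtain ⟨w, hw⟩ := hsurj (Q (b - (l b / l (fderiv ℝ f y a)) • fderiv ℝ f y a))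
    rw [hgd] at hw
    have hbker : b - (l b / l (fderiv ℝ f y a)) • fderiv ℝ f y a ∈ l.ker := by
      simp [ha]
    have h1 := hQ ⟨_, htan w⟩
    have h2 := hQ ⟨_, hbker⟩
    have h3 := congrArg Subtype.val (h1.symm.trans (hw.trans h2))
    simp only at h3
    refine ⟨fderiv ℝ ι (e y).2 w + (l b / l (fderiv ℝ f y a)) • a, ?_⟩
    rw [map_add, map_smul, h3, sub_add_cancel]
  · simp only [hιy, hfy, add_sub_cancel_left]
    exact hQ z

/-- The induction for Sard's theorem, over the three parts of the critical set: the points where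
the derivative does not vanish, those where the first nonvanishing derivative has order `k + 1 ≥ 2`,
and those where all derivatives up to the order `dim E` vanish. -/
theorem sardBelow (d : ℕ) : SardBelow.{u} d := by
  induction d with
  | zero => exact fun _ _ _ _ _ _ _ _ _ _ _ _ _ _ h => absurd h (Nat.not_lt_zero _)
  | succ d ihd =>
  intro E F _ _ _ _ _ _ _ _ μ _ f U hd hU hf
  have ih : SardBelow.{u} (Module.finrank ℝ E) :=
    fun E' F' _ _ _ _ _ _ _ _ ν _ g V hlt => ihd E' F' ν g V (by omega)
  rcases subsingleton_or_nontrivial F with hF | hF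
  · have : {x ∈ U | ¬ Function.Surjective (fderiv ℝ f x)} = ∅ :=
      Set.eq_empty_of_forall_notMem fun x hx => hx.2 fun y => ⟨0, Subsingleton.elim _ _⟩
    simp [this]
  set n := Module.finrank ℝ E with hn
  let flat : Set E := {x ∈ U | ∀ i, 1 ≤ i → i ≤ n → iteratedFDeriv ℝ i f x = 0}
  let C₁ : Set E := {x ∈ U | fderiv ℝ f x ≠ 0 ∧ ¬ Function.Surjective (fderiv ℝ f x)}
  let D : ℕ → Set E := fun k =>
    {x ∈ U | fderiv ℝ f x = 0 ∧ iteratedFDeriv ℝ k f x = 0 ∧ iteratedFDeriv ℝ (k + 1) f x ≠ 0}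
  have hcover : {x ∈ U | ¬ Function.Surjective (fderiv ℝ f x)} ⊆ flat ∪ (C₁ ∪ ⋃ k, D k) := by
    intro x hx
    by_cases h1 : fderiv ℝ f x = 0
    · by_cases h2 : ∀ i, 1 ≤ i → i ≤ n → iteratedFDeriv ℝ i f x = 0
      · exact Or.inl ⟨hx.1, h2⟩
      · -- The first derivative that does not vanish.
        push Not at h2
        have hex : ∃ k, iteratedFDeriv ℝ (k + 1) f x ≠ 0 := by
          obtain ⟨i, hi, -, h⟩ := h2
          exact ⟨i - 1, by rwa [Nat.sub_add_cancel hi]⟩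
        classical
        have hfind := Nat.find_spec hex
        obtain ⟨k, hk⟩ : ∃ k, Nat.find hex = k + 1 := by
          refine Nat.exists_eq_succ_of_ne_zero fun h0 => ?_
          rw [h0, ← norm_ne_zero_iff, zero_add, norm_iteratedFDeriv_one, h1, norm_zero] at hfind
          exact hfind rfl
        have hmin := Nat.find_min hex (m := k) (by omega)
        rw [hk] at hfind
        exact Or.inr (Or.inr (Set.mem_iUnion.2 ⟨k + 1, hx.1, h1, not_not.1 hmin, hfind⟩))
    · exact Or.inr (Or.inl ⟨hx.1, h1, hx.2⟩)
  refine measure_mono_null (Set.image_mono hcover) ?_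
  rw [Set.image_union, Set.image_union, Set.image_iUnion, measure_union_null_iff,
    measure_union_null_iff, measure_iUnion_null_iff]
  refine ⟨measure_image_flat_eq_zero μ hU hf, ?_, fun k => ?_⟩
  · refine measure_image_null_of_locally_null μ f C₁ fun x hx => ?_
    obtain ⟨W, hW, h0⟩ :=
      exists_nhds_measure_image_eq_zero_of_fderiv_ne_zero ih μ hU hf hx.1 hx.2.1
    refine ⟨W ∩ C₁, Filter.inter_mem (mem_nhdsWithin_of_mem_nhds hW) self_mem_nhdsWithin,
      measure_mono_null (Set.image_mono fun y hy => ?_) h0⟩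
    exact ⟨hy.1, hy.2.2.2⟩
  · refine measure_image_null_of_locally_null μ f (D k) fun x hx => ?_
    obtain ⟨W, hW, h0⟩ :=
      exists_nhds_measure_image_eq_zero_of_iteratedFDeriv_ne_zero ih μ hU hf hx.1 hx.2.2.2
    refine ⟨W ∩ D k, Filter.inter_mem (mem_nhdsWithin_of_mem_nhds hW) self_mem_nhdsWithin,
      measure_mono_null (Set.image_mono fun y hy => ?_) h0⟩
    exact ⟨hy.1, hy.2.2.1, hy.2.2.2.1⟩

/-- **Sard's theorem**: the critical values of a smooth map form a null set. -/
theorem measure_image_critical_eq_zero (μ : Measure F) [μ.IsAddHaarMeasure] {f : E → F}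
    {U : Set E} (hU : IsOpen U) (hf : ContDiffOn ℝ ∞ f U) :
    μ (f '' {x ∈ U | ¬ Function.Surjective (fderiv ℝ f x)}) = 0 :=
  sardBelow _ E F μ f U (Nat.lt_succ_self _) hU hf

end Sard

/-! ### Parametric transversality -/

section Transversality

/-- An exceptional null set of parameters that may depend on the point can be chosen uniformly, if
it can be chosen so near each point. -/
theorem ae_forall_mem_of_locally {X T : Type*} [TopologicalSpace X] [SecondCountableTopology X]
    [MeasurableSpace T] {ν : Measure T} {U : Set X} {p : X → T → Prop}
    (h : ∀ x ∈ U, ∃ W ∈ 𝓝 x, ∀ᵐ t ∂ν, ∀ y ∈ W ∩ U, p y t) : ∀ᵐ t ∂ν, ∀ x ∈ U, p x t := by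
  choose! W hW hp using h
  obtain ⟨s, hsU, hs, hcover⟩ := TopologicalSpace.countable_cover_nhdsWithin
    (fun x hx => mem_nhdsWithin_of_mem_nhds (hW x hx))
  filter_upwards [(ae_ball_iff hs).2 fun x hx => hp x (hsU hx)] with t ht x hx
  obtain ⟨y, hy, hxy⟩ := Set.mem_iUnion₂.1 (hcover hx)
  exact ht y hy x ⟨hxy, hx⟩

universe u

variable {E F : Type u} [NormedAddCommGroup E] [NormedSpace ℝ E]
  [NormedAddCommGroup F] [NormedSpace ℝ F]
  {P : Type*} [NormedAddCommGroup P] [NormedSpace ℝ P]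

theorem fderiv_add_clm_apply {f : E → F} {A : E → P →L[ℝ] F} {x : E}
    (hf : DifferentiableAt ℝ f x) (hA : DifferentiableAt ℝ A x) (t : P) :
    fderiv ℝ (fun y => f y + A y t) x =
      fderiv ℝ f x + (ContinuousLinearMap.apply ℝ F t).comp (fderiv ℝ A x) :=
  (hf.hasFDerivAt.add
    ((ContinuousLinearMap.apply ℝ F t).hasFDerivAt.comp x hA.hasFDerivAt)).fderiv

variable [FiniteDimensional ℝ F]

/-- The set of bad parameters over a compact set is closed, being the projection of a closed set
along a compact factor. In particular it is measurable. -/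
theorem isClosed_setOf_exists_not_surjective {f : E → F} {A : E → P →L[ℝ] F} {U K : Set E}
    (hU : IsOpen U) (hf : ContDiffOn ℝ ∞ f U) (hA : ContDiffOn ℝ ∞ A U) (hK : IsCompact K)
    (hKU : K ⊆ U) :
    IsClosed {t : P | ∃ x ∈ K, f x + A x t = 0 ∧
      ¬ Function.Surjective (fderiv ℝ (fun y => f y + A y t) x)} := by
  have : CompactSpace K := isCompact_iff_compactSpace.1 hK
  have hfK : Continuous fun x : K => f x :=
    continuousOn_iff_continuous_domRestrict.1 (hf.continuousOn.mono hKU)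
  have hAK : Continuous fun x : K => A x :=
    continuousOn_iff_continuous_domRestrict.1 (hA.continuousOn.mono hKU)
  have hfK' : Continuous fun x : K => fderiv ℝ f x := continuousOn_iff_continuous_domRestrict.1
    ((hf.continuousOn_fderiv_of_isOpen hU (by simp)).mono hKU)
  have hAK' : Continuous fun x : K => fderiv ℝ A x := continuousOn_iff_continuous_domRestrict.1
    ((hA.continuousOn_fderiv_of_isOpen hU (by simp)).mono hKU)
  have h1 : Continuous fun p : K × P => f p.1 + A p.1 p.2 :=
    (hfK.comp continuous_fst).add ((hAK.comp continuous_fst).clm_apply continuous_snd)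
  have h2 : Continuous fun p : K × P =>
      fderiv ℝ f p.1 + (ContinuousLinearMap.apply ℝ F p.2).comp (fderiv ℝ A p.1) :=
    (hfK'.comp continuous_fst).add
      (((ContinuousLinearMap.apply ℝ F).continuous.comp continuous_snd).clm_comp
        (hAK'.comp continuous_fst))
  have hZ := isClosedMap_snd_of_compactSpace _
    ((isClosed_singleton (x := (0 : F)).preimage h1).inter
    ((isOpen_setOf_surjective (E := E) (F := F)).isClosed_compl.preimage h2))
  convert hZ using 1
  ext t
  constructor
  · rintro ⟨x, hx, h0, hs⟩
    refine ⟨(⟨x, hx⟩, t), ⟨h0, fun h => hs ?_⟩, rfl⟩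
    rwa [fderiv_add_clm_apply]
    · exact (hf.contDiffAt (hU.mem_nhds (hKU hx))).differentiableAt (by simp)
    · exact (hA.contDiffAt (hU.mem_nhds (hKU hx))).differentiableAt (by simp)
  · rintro ⟨⟨⟨x, hx⟩, t'⟩, ⟨h0, hs⟩, rfl⟩
    refine ⟨x, hx, h0, fun h => hs ?_⟩
    rwa [fderiv_add_clm_apply] at h
    · exact (hf.contDiffAt (hU.mem_nhds (hKU hx))).differentiableAt (by simp)
    · exact (hA.contDiffAt (hU.mem_nhds (hKU hx))).differentiableAt (by simp)

/-- Let `f + A t` be a family of maps that depends affinely on a parameter `t`, with `A x` onto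
for all `x`. If `B` is a right inverse of `A x₀`, then for `x` near `x₀` the equation
`f x + A x (t + B s) = 0` reads `s = G x` with `G = -(A B)⁻¹ (f + A t)`, and the zeros are
regular if and only if `s` is a regular value of `G`. So Sard's theorem for `G` shows that almost
every parameter in each translate of the range of `B` is good. -/
theorem ae_surjective_fderiv_of_surjective [FiniteDimensional ℝ E] [FiniteDimensional ℝ P]
    [MeasurableSpace P] [BorelSpace P] (ν : Measure P)
    [ν.IsAddHaarMeasure] {f : E → F} {A : E → P →L[ℝ] F} {U : Set E} (hU : IsOpen U)
    (hf : ContDiffOn ℝ ∞ f U) (hA : ContDiffOn ℝ ∞ A U)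
    (hs : ∀ x ∈ U, Function.Surjective (A x)) :
    ∀ᵐ t ∂ν, ∀ x ∈ U, f x + A x t = 0 →
      Function.Surjective (fderiv ℝ (fun y => f y + A y t) x) := by
  refine ae_forall_mem_of_locally fun x₀ hx₀ => ?_
  have : CompleteSpace F := FiniteDimensional.complete ℝ F
  obtain ⟨B, hB⟩ := (A x₀).exists_rightInverse_of_surjective (LinearMap.range_eq_top.2 (hs x₀ hx₀))
  let T : E → F →L[ℝ] F := fun x => (A x).comp B
  have hT : ContDiffOn ℝ ∞ T U := hA.clm_comp contDiffOn_const
  let W : Set E := U ∩ T ⁻¹' Set.range ((↑) : (F ≃L[ℝ] F) → F →L[ℝ] F)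
  have hW : IsOpen W := hT.continuousOn.isOpen_inter_preimage hU ContinuousLinearEquiv.isOpen
  have hWU : W ⊆ U := Set.inter_subset_left
  obtain ⟨K, hK, hKW, hKc⟩ :=
    local_compact_nhds (hW.mem_nhds (show x₀ ∈ W from ⟨hx₀, .refl ℝ F, hB.symm⟩))
  refine ⟨K, hK, ?_⟩
  set S : Set P := {t : P | ∃ x ∈ K, f x + A x t = 0 ∧
      ¬ Function.Surjective (fderiv ℝ (fun y => f y + A y t) x)} with hS
  have hSc : IsClosed S := isClosed_setOf_exists_not_surjective hU hf hA hKc (hKW.trans hWU)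
  suffices h : ∀ᵐ t ∂ν, t ∈ Sᶜ by
    filter_upwards [h] with t ht x hx h0
    by_contra hns
    exact ht ⟨x, hx.1, h0, hns⟩
  borelize F
  refine ae_mem_of_ae_add_linearMap_mem (B : F →ₗ[ℝ] P) (Measure.addHaar : Measure F) ν
    hSc.measurableSet.compl fun t => ?_
  let G : E → F := fun x => -(T x).inverse (f x + A x t)
  have hG : ContDiffOn ℝ ∞ G W := by
    refine ContDiffOn.neg (ContDiffOn.clm_apply (fun x hx => ?_)
      ((hf.mono hWU).add ((hA.mono hWU).clm_apply contDiffOn_const)))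
    obtain ⟨L, hL⟩ := hx.2
    have h1 : ContDiffAt ℝ ∞ ContinuousLinearMap.inverse (T x) := hL ▸ contDiffAt_map_inverse L
    exact (h1.comp x (hT.contDiffAt (hU.mem_nhds hx.1))).contDiffWithinAt
  have hnull := measure_image_critical_eq_zero (Measure.addHaar : Measure F) hW hG
  rw [ae_iff]
  refine measure_mono_null (fun s hs => ?_) hnull
  obtain ⟨x, hxK, h0, hns⟩ : t + B s ∈ S := by simpa using hs
  have hxW := hKW hxK
  -- The family near `x`, written with `G`.
  have hrew (y : E) (hy : y ∈ W) : f y + A y (t + B s) = T y (s - G y) := by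
    obtain ⟨L, hL⟩ := hy.2
    have hinv : T y (G y) = -(f y + A y t) := by
      simp [G, ← hL]
    rw [map_sub, hinv, map_add]
    simp only [T, ContinuousLinearMap.comp_apply]
    abel
  obtain ⟨L, hL⟩ := hxW.2
  have hsG : s = G x := by
    rw [hrew x hxW, ← hL] at h0
    exact sub_eq_zero.1 (L.map_eq_zero_iff.1 h0)
  refine ⟨x, ⟨hxW, fun hsurj => hns ?_⟩, hsG.symm⟩
  have hTd := ((hT.contDiffAt (hU.mem_nhds hxW.1)).differentiableAt (by simp)).hasFDerivAt
  have hGd := ((hG.contDiffAt (hW.mem_nhds hxW)).differentiableAt (by simp)).hasFDerivAt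
  have hd := (hTd.clm_apply (hGd.const_sub s)).congr_of_eventuallyEq
    (Filter.eventually_of_mem (hW.mem_nhds hxW) hrew)
  rw [hd.fderiv]
  intro z
  obtain ⟨v, hv⟩ := hsurj (-(L.symm z))
  exact ⟨v, by simp [hsG, hv, ← hL]⟩

/-- If `‖f‖` is locally bounded by a multiple of `‖g‖` and `g x = 0`, then the kernel of `Dg(x)`
lies in that of `Df(x)`, so that `Dg(x)` is onto if `Df(x)` is. -/
theorem surjective_fderiv_of_isBigO [FiniteDimensional ℝ E] {f g : E → F} {x : E}
    (hf : DifferentiableAt ℝ f x)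
    (hg : DifferentiableAt ℝ g x) (hfg : f =O[𝓝 x] g) (hgx : g x = 0)
    (hs : Function.Surjective (fderiv ℝ f x)) : Function.Surjective (fderiv ℝ g x) := by
  have hfx : f x = 0 := by
    obtain ⟨c, hc⟩ := hfg.bound
    simpa [hgx] using hc.self_of_nhds
  have hker : (fderiv ℝ g x).ker ≤ (fderiv ℝ f x).ker := by
    intro v hv
    have hline : Filter.Tendsto (fun r : ℝ => x + r • v) (𝓝 0) (𝓝 x) := by
      have : Continuous fun r : ℝ => x + r • v := by fun_prop
      simpa using this.tendsto 0
    have hder (h : E → F) (hh : DifferentiableAt ℝ h x) :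
        HasDerivAt (fun r : ℝ => h (x + r • v)) (fderiv ℝ h x v) 0 :=
      hh.hasFDerivAt.hasLineDerivAt v
    have hgo : (fun r : ℝ => g (x + r • v)) =o[𝓝 0] fun r : ℝ => r := by
      have := (hder g hg).isLittleO
      rw [show fderiv ℝ g x v = 0 from hv] at this
      simpa [hgx] using this
    have hfo : (fun r : ℝ => f (x + r • v)) =o[𝓝 0] fun r : ℝ => r :=
      (hfg.comp_tendsto hline).trans_isLittleO hgo
    have h0 : HasDerivAt (fun r : ℝ => f (x + r • v)) 0 0 := by
      rw [hasDerivAt_iff_isLittleO]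
      simpa [hfx] using hfo
    exact (hder f hf).unique h0
  have h1 := (fderiv ℝ f x : E →ₗ[ℝ] F).finrank_range_add_finrank_ker
  have h2 := (fderiv ℝ g x : E →ₗ[ℝ] F).finrank_range_add_finrank_ker
  have h3 := Submodule.finrank_mono hker
  rw [LinearMap.range_eq_top.2 (show Function.Surjective (fderiv ℝ f x : E →ₗ[ℝ] F) from hs),
    finrank_top] at h1
  refine LinearMap.range_eq_top.1 (Submodule.eq_top_of_finrank_eq (le_antisymm
    (Submodule.finrank_le _) ?_))
  change Module.finrank ℝ (LinearMap.ker (fderiv ℝ g x : E →ₗ[ℝ] F)) ≤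
    Module.finrank ℝ (LinearMap.ker (fderiv ℝ f x : E →ₗ[ℝ] F)) at h3
  omega

end Transversality

/-! ### Maps on manifolds in coordinates -/

section Coordinates

variable {n : ℕ} {M : Type*} [TopologicalSpace M] [ChartedSpace (EuclideanSpace ℝ (Fin (2 * n))) M]
  [IsManifold (𝓡 (2 * n)) ∞ M] {F' : Type*} [NormedAddCommGroup F'] [NormedSpace ℝ F']

theorem contDiffOn_comp_chartAt_symm {F : M → F'} {U : Set M}
    (hF : ContMDiffOn (𝓡 (2 * n)) 𝓘(ℝ, F') ∞ F U) (x : M) :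
    ContDiffOn ℝ ∞ (F ∘ (chartAt (EuclideanSpace ℝ (Fin (2 * n))) x).symm)
      ((chartAt (EuclideanSpace ℝ (Fin (2 * n))) x).target ∩
        (chartAt (EuclideanSpace ℝ (Fin (2 * n))) x).symm ⁻¹' U) :=
  contMDiffOn_iff_contDiffOn.1 (hF.comp'
    (contMDiffOn_chart_symm (I := 𝓡 (2 * n)) (n := ∞) (x := x)))

theorem surjective_mfderiv_iff {F : M → F'} {x y : M}
    (hy : y ∈ (chartAt (EuclideanSpace ℝ (Fin (2 * n))) x).source)
    (hF : MDifferentiableAt (𝓡 (2 * n)) 𝓘(ℝ, F') F y) :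
    Function.Surjective (mfderiv (𝓡 (2 * n)) 𝓘(ℝ, F') F y) ↔
      Function.Surjective (fderiv ℝ (F ∘ (chartAt (EuclideanSpace ℝ (Fin (2 * n))) x).symm)
        (chartAt (EuclideanSpace ℝ (Fin (2 * n))) x y)) := by
  set φ := chartAt (EuclideanSpace ℝ (Fin (2 * n))) x with hφ
  have hat : φ ∈ IsManifold.maximalAtlas (𝓡 (2 * n)) ∞ M := IsManifold.chart_mem_maximalAtlas x
  have h1 : MDifferentiableAt (𝓡 (2 * n)) (𝓡 (2 * n)) φ y :=
    (contMDiffAt_of_mem_maximalAtlas hat hy).mdifferentiableAt (by simp)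
  have h2 : MDifferentiableAt (𝓡 (2 * n)) (𝓡 (2 * n)) φ.symm (φ y) :=
    (contMDiffAt_symm_of_mem_maximalAtlas hat (φ.map_source hy)).mdifferentiableAt (by simp)
  have hF' : MDifferentiableAt (𝓡 (2 * n)) 𝓘(ℝ, F') F (φ.symm (φ y)) := by
    rwa [φ.left_inv hy]
  rw [← mfderiv_eq_fderiv]
  constructor
  · intro hs
    have hG : MDifferentiableAt (𝓡 (2 * n)) 𝓘(ℝ, F') (F ∘ φ.symm) (φ y) := hF'.comp _ h2
    have heq : F =ᶠ[𝓝 y] (F ∘ φ.symm) ∘ φ := by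
      filter_upwards [φ.open_source.mem_nhds hy] with z hz
      simp [φ.left_inv hz]
    have hc := mfderiv_comp y hG h1
    rw [← heq.mfderiv_eq] at hc
    intro z
    obtain ⟨v, hv⟩ := hs z
    refine ⟨mfderiv (𝓡 (2 * n)) (𝓡 (2 * n)) φ y v, ?_⟩
    rw [hc] at hv
    exact hv
  · intro hs
    have hc := mfderiv_comp (φ y) hF' h2
    rw [φ.left_inv hy] at hc
    intro z
    obtain ⟨v, hv⟩ := hs z
    refine ⟨mfderiv (𝓡 (2 * n)) (𝓡 (2 * n)) φ.symm (φ y) v, ?_⟩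
    rw [hc] at hv
    exact hv

omit [IsManifold (𝓡 (2 * n)) ∞ M] in
theorem isOpen_chartAt_target_inter {U : Set M} (hU : IsOpen U) (x : M) :
    IsOpen ((chartAt (EuclideanSpace ℝ (Fin (2 * n))) x).target ∩
      (chartAt (EuclideanSpace ℝ (Fin (2 * n))) x).symm ⁻¹' U) :=
  (chartAt (EuclideanSpace ℝ (Fin (2 * n))) x).isOpen_inter_preimage_symm hU

variable {m : ℕ} {F : M → EuclideanSpace ℝ (Fin m)} {U : Set M}

/-- Sard's theorem on a manifold. -/
theorem ae_isRegularValueOn [SecondCountableTopology M] (hU : IsOpen U)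
    (hF : ContMDiffOn (𝓡 (2 * n)) (𝓡 m) ∞ F U) :
    ∀ᵐ c ∂(volume : Measure (EuclideanSpace ℝ (Fin m))), IsRegularValueOn (n := n) F U c := by
  refine ae_forall_mem_of_locally fun x _ => ?_
  set φ := chartAt (EuclideanSpace ℝ (Fin (2 * n))) x with hφ
  refine ⟨φ.source, φ.open_source.mem_nhds (mem_chart_source _ x), ?_⟩
  have h0 := measure_image_critical_eq_zero (volume : Measure (EuclideanSpace ℝ (Fin m)))
    (isOpen_chartAt_target_inter hU x) (contDiffOn_comp_chartAt_symm hF x)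
  rw [← hφ] at h0
  filter_upwards [measure_eq_zero_iff_ae_notMem.1 h0] with c hc y hy hyc
  by_contra hns
  have hyd : MDifferentiableAt (𝓡 (2 * n)) (𝓡 m) F y :=
    (hF.contMDiffAt (hU.mem_nhds hy.2)).mdifferentiableAt (by simp)
  refine hc ⟨φ y, ⟨⟨φ.map_source hy.1, ?_⟩, fun h => hns ?_⟩, ?_⟩
  · simpa [φ.left_inv hy.1] using hy.2
  · exact (surjective_mfderiv_iff hy.1 hyd).2 h
  · simpa [φ.left_inv hy.1] using hyc

theorem isOpen_setOf_isRegularAt (hU : IsOpen U)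
    (hF : ContMDiffOn (𝓡 (2 * n)) (𝓡 m) ∞ F U) :
    IsOpen {x ∈ U | IsRegularAt (n := n) F x} := by
  refine isOpen_iff_mem_nhds.2 fun x ⟨hxU, hx⟩ => ?_
  set φ := chartAt (EuclideanSpace ℝ (Fin (2 * n))) x with hφ
  have hdiff (y : M) (hy : y ∈ U) : MDifferentiableAt (𝓡 (2 * n)) (𝓡 m) F y :=
    (hF.contMDiffAt (hU.mem_nhds hy)).mdifferentiableAt (by simp)
  have hW := isOpen_chartAt_target_inter (n := n) hU x
  have hG := contDiffOn_comp_chartAt_symm hF x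
  rw [← hφ] at hW hG
  have hO := (hG.continuousOn_fderiv_of_isOpen hW (by simp)).isOpen_inter_preimage hW
    isOpen_setOf_surjective
  have hxs := mem_chart_source (EuclideanSpace ℝ (Fin (2 * n))) x
  rw [← hφ] at hxs
  have hpre := φ.isOpen_inter_preimage hO
  refine Filter.mem_of_superset (hpre.mem_nhds ⟨hxs, ⟨φ.map_source hxs, ?_⟩,
    (surjective_mfderiv_iff hxs (hdiff x hxU)).1 hx⟩) ?_
  · simpa [φ.left_inv hxs] using hxU
  · rintro y ⟨hys, ⟨-, hyU⟩, hy⟩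
    have hyU' : y ∈ U := by simpa [φ.left_inv hys] using hyU
    exact ⟨hyU', (surjective_mfderiv_iff hys (hdiff y hyU')).2 hy⟩

theorem isRegularAt_of_isBigO {G : M → EuclideanSpace ℝ (Fin m)} {x : M}
    (hF : MDifferentiableAt (𝓡 (2 * n)) (𝓡 m) F x) (hG : MDifferentiableAt (𝓡 (2 * n)) (𝓡 m) G x)
    (hFG : F =O[𝓝 x] G) (hGx : G x = 0) (hx : IsRegularAt (n := n) F x) :
    IsRegularAt (n := n) G x := by
  have hxs := mem_chart_source (EuclideanSpace ℝ (Fin (2 * n))) x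
  set φ := chartAt (EuclideanSpace ℝ (Fin (2 * n))) x with hφ
  have hat : φ ∈ IsManifold.maximalAtlas (𝓡 (2 * n)) ∞ M := IsManifold.chart_mem_maximalAtlas x
  have h2 : MDifferentiableAt (𝓡 (2 * n)) (𝓡 (2 * n)) φ.symm (φ x) :=
    (contMDiffAt_symm_of_mem_maximalAtlas hat (φ.map_source hxs)).mdifferentiableAt (by simp)
  have hd (K : M → EuclideanSpace ℝ (Fin m)) (hK : MDifferentiableAt (𝓡 (2 * n)) (𝓡 m) K x) :
      DifferentiableAt ℝ (K ∘ φ.symm) (φ x) := by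
    rw [← φ.left_inv hxs] at hK
    exact (hK.comp _ h2).differentiableAt
  have ht : Filter.Tendsto φ.symm (𝓝 (φ x)) (𝓝 x) := by
    have := (φ.continuousAt_symm (φ.map_source hxs)).tendsto
    rwa [φ.left_inv hxs] at this
  refine (surjective_mfderiv_iff hxs hG).2 (surjective_fderiv_of_isBigO (hd F hF) (hd G hG)
    (hFG.comp_tendsto ht) (by simp [hGx]) ((surjective_mfderiv_iff hxs hF).1 hx))

end Coordinates

/-! ### Regular level sets -/

section LevelSets

variable {n : ℕ} {M : Type*} [TopologicalSpace M] [ChartedSpace (EuclideanSpace ℝ (Fin (2 * n))) M]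
  [IsManifold (𝓡 (2 * n)) ∞ M] {m : ℕ}

/-- Linear coordinates on `ℝ^m × K` in which the last `m` coordinates cut out the factor `K`. -/
theorem exists_equiv_prod_euclideanSpace {N : ℕ} (hm : m ≤ N) {K : Type*} [NormedAddCommGroup K]
    [NormedSpace ℝ K] [FiniteDimensional ℝ K] (hK : Module.finrank ℝ K = N - m) :
    ∃ L : (EuclideanSpace ℝ (Fin m) × K) ≃L[ℝ] EuclideanSpace ℝ (Fin N),
      ∀ p, (∀ i : Fin N, N - m ≤ (i : ℕ) → L p i = 0) ↔ p.1 = 0 := by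
  let b : K ≃ₗ[ℝ] (Fin (N - m) → ℝ) := LinearEquiv.ofFinrankEq _ _ (by simp [hK])
  let T : (EuclideanSpace ℝ (Fin m) × K) →ₗ[ℝ] EuclideanSpace ℝ (Fin N) :=
    { toFun := fun p => WithLp.toLp 2 fun i =>
        if h : (i : ℕ) < N - m then b p.2 ⟨i, h⟩ else p.1 ⟨i - (N - m), by omega⟩
      map_add' := fun p q => by
        ext i
        by_cases h : (i : ℕ) < N - m <;> simp [h]
      map_smul' := fun c p => by
        ext i
        by_cases h : (i : ℕ) < N - m <;> simp [h] }
  have hT (p) (i : Fin N) : T p i =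
      if h : (i : ℕ) < N - m then b p.2 ⟨i, h⟩ else p.1 ⟨i - (N - m), by omega⟩ := rfl
  have hzero (p) : (∀ i : Fin N, N - m ≤ (i : ℕ) → T p i = 0) ↔ p.1 = 0 := by
    constructor
    · intro h
      ext j
      have := h ⟨N - m + j, by omega⟩ (by simp)
      simpa [hT] using this
    · intro h i hi
      simp [hT, not_lt.2 hi, h]
  have hinj : Function.Injective T := by
    rw [← LinearMap.ker_eq_bot, LinearMap.ker_eq_bot']
    intro p hp
    have h1 : p.1 = 0 := (hzero p).1 fun i _ => by simp [hp]
    have h2 : b p.2 = 0 := by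
      funext j
      have : T p ⟨j, by omega⟩ = 0 := by simp [hp]
      simpa [hT] using this
    exact Prod.ext h1 (b.map_eq_zero_iff.1 h2)
  let L := LinearEquiv.ofInjectiveOfFinrankEq T hinj (by
    simp only [Module.finrank_prod, finrank_euclideanSpace, Fintype.card_fin, hK]
    omega)
  exact ⟨L.toContinuousLinearEquiv, hzero⟩

/-- Near a regular point the level set of `F` is a coordinate slice. -/
theorem exists_slice_chart {F : M → EuclideanSpace ℝ (Fin m)} {U : Set M} (hU : IsOpen U)
    (hF : ContMDiffOn (𝓡 (2 * n)) (𝓡 m) ∞ F U) {p : M} (hp : p ∈ U)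
    (hreg : IsRegularAt (n := n) F p) :
    ∃ e ∈ IsManifold.maximalAtlas (𝓡 (2 * n)) ∞ M, p ∈ e.source ∧ e.source ⊆ U ∧
      ∀ q ∈ e.source, F q = F p ↔ ∀ i : Fin (2 * n), 2 * n - m ≤ (i : ℕ) → e q i = 0 := by
  have hps := mem_chart_source (EuclideanSpace ℝ (Fin (2 * n))) p
  have hW := isOpen_chartAt_target_inter (n := n) hU p
  have hG := contDiffOn_comp_chartAt_symm hF p
  have hregG := (surjective_mfderiv_iff hps
    ((hF.contMDiffAt (hU.mem_nhds hp)).mdifferentiableAt (by simp))).1 hreg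
  have hatl : chartAt (EuclideanSpace ℝ (Fin (2 * n))) p ∈
      IsManifold.maximalAtlas (𝓡 (2 * n)) ∞ M := IsManifold.chart_mem_maximalAtlas p
  generalize chartAt (EuclideanSpace ℝ (Fin (2 * n))) p = φ at hps hW hG hregG hatl
  have hG' : ContDiffOn ℝ ∞ (fun y => (F ∘ φ.symm) y - F p) (φ.target ∩ φ.symm ⁻¹' U) :=
    hG.sub contDiffOn_const
  have hpW : φ p ∈ φ.target ∩ φ.symm ⁻¹' U :=
    ⟨φ.map_source hps, by simpa [φ.left_inv hps] using hp⟩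
  obtain ⟨e, hpe, heW, he1, hes, hes'⟩ := exists_straightening hW hG' hpW
    (by rwa [fderiv_sub_const])
  have hfin := finrank_ker_add (A := fderiv ℝ (fun y => (F ∘ φ.symm) y - F p) (φ p))
    (by rwa [fderiv_sub_const])
  simp only [finrank_euclideanSpace, Fintype.card_fin] at hfin
  obtain ⟨L, hL⟩ := exists_equiv_prod_euclideanSpace (m := m) (N := 2 * n) (by omega)
    (K := (fderiv ℝ (fun y => (F ∘ φ.symm) y - F p) (φ p)).ker) (by omega)
  let ψ := φ.trans (e.trans L.toHomeomorph.toOpenPartialHomeomorph)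
  have hsource : ψ.source = φ.source ∩ φ ⁻¹' e.source := by simp [ψ]
  refine ⟨ψ, ψ.mem_maximalAtlas_of_contMDiffOn ?_ ?_, ?_, ?_, ?_⟩
  · have h1 : ContMDiffOn (𝓡 (2 * n)) (𝓡 (2 * n)) ∞ (fun y => L (e y)) e.source :=
      (L.contDiff.comp_contDiffOn hes).contMDiffOn
    rw [hsource]
    exact h1.comp' (contMDiffOn_of_mem_maximalAtlas hatl)
  · have h1 : ContMDiffOn (𝓡 (2 * n)) (𝓡 (2 * n)) ∞ (fun z => e.symm (L.symm z))
        (L.symm ⁻¹' e.target) :=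
      (hes'.comp L.symm.contDiff.contDiffOn fun z hz => hz).contMDiffOn
    refine ((contMDiffOn_symm_of_mem_maximalAtlas hatl).comp' h1).mono ?_
    intro z hz
    simpa [ψ] using hz
  · rw [hsource]
    exact ⟨hps, hpe⟩
  · intro q hq
    rw [hsource] at hq
    have := (heW hq.2).2
    simpa [φ.left_inv hq.1] using this
  · intro q hq
    rw [hsource] at hq
    have h1 : ψ q = L (e (φ q)) := rfl
    have h2 : (e (φ q)).1 = F q - F p := by simp [he1, φ.left_inv hq.1]
    rw [h1, hL, h2, sub_eq_zero]

/-- A set that is near each of its points a level set of a smooth map to `ℝ^m`, regular at that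
point, is a submanifold of codimension `m`. -/
theorem isSmoothSubmanifold_of_locally {S : Set M}
    (h : ∀ p ∈ S, ∃ (F : M → EuclideanSpace ℝ (Fin m)) (U : Set M), IsOpen U ∧ p ∈ U ∧
      ContMDiffOn (𝓡 (2 * n)) (𝓡 m) ∞ F U ∧ IsRegularAt (n := n) F p ∧
      ∀ q ∈ U, q ∈ S ↔ F q = F p) :
    IsSmoothSubmanifold (n := n) (2 * n - m) S := by
  refine ⟨Nat.sub_le _ _, fun p hp => ?_⟩
  obtain ⟨F, U, hU, hpU, hF, hreg, hS⟩ := h p hp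
  obtain ⟨e, he, hpe, heU, hslice⟩ := exists_slice_chart hU hF hpU hreg
  exact ⟨e, he, hpe, fun q hq => (hS q (heU hq)).trans (hslice q hq)⟩

end LevelSets

/-! ### Local frames -/

section Frames

/-- The coefficients with respect to a continuous family of linearly independent vectors are locally
bounded by the vector they represent. -/
theorem eventually_norm_le_of_linearIndependent {X E ι : Type*} [TopologicalSpace X] [Fintype ι]
    [NormedAddCommGroup E] [NormedSpace ℝ E] [FiniteDimensional ℝ E] {w : ι → X → E} {x : X}
    (hw : ∀ j, ContinuousAt (w j) x) (hx : LinearIndependent ℝ fun j => w j x) :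
    ∃ C : ℝ, ∀ᶠ y in 𝓝 x, ∀ a : ι → ℝ, ‖a‖ ≤ C * ‖∑ j, a j • w j y‖ := by
  classical
  let T : X → (ι → ℝ) →L[ℝ] E := fun y =>
    ∑ j, (ContinuousLinearMap.smulRightL ℝ (ι → ℝ) E (ContinuousLinearMap.proj j)) (w j y)
  have hT (y : X) (a : ι → ℝ) : T y a = ∑ j, a j • w j y := by simp [T]
  have hTc : ContinuousAt T x := by
    refine tendsto_finsetSum _ fun j _ => ?_
    exact ((ContinuousLinearMap.smulRightL ℝ (ι → ℝ) E
      (ContinuousLinearMap.proj j)).continuous.tendsto _).comp (hw j)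
  obtain ⟨P, hP⟩ : ∃ P : E →L[ℝ] (ι → ℝ), P.comp (T x) = ContinuousLinearMap.id ℝ _ := by
    have hinj : LinearMap.ker (T x : (ι → ℝ) →ₗ[ℝ] E) = ⊥ := by
      refine LinearMap.ker_eq_bot'.2 fun a ha => funext fun j => ?_
      exact Fintype.linearIndependent_iff.1 hx a ((hT x a).symm.trans ha) j
    obtain ⟨P, hP⟩ := (T x : (ι → ℝ) →ₗ[ℝ] E).exists_leftInverse_of_injective hinj
    exact ⟨P.toContinuousLinearMap, ContinuousLinearMap.coe_injective hP⟩
  have hc : ContinuousAt (fun y => P.comp (T y)) x := continuousAt_const.clm_comp hTc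
  have hev : ∀ᶠ y in 𝓝 x, ‖P.comp (T y) - P.comp (T x)‖ < 1 / 2 := by
    have := (hc.sub (continuousAt_const (y := P.comp (T x)))).norm.eventually_lt
      (continuousAt_const (y := (1 / 2 : ℝ))) (by simp)
    exact this
  refine ⟨2 * ‖P‖, hev.mono fun y hy a => ?_⟩
  have h1 : ‖(P.comp (T y) - P.comp (T x)) a‖ ≤ 1 / 2 * ‖a‖ :=
    (ContinuousLinearMap.le_opNorm _ _).trans (by gcongr)
  have h2 : ‖a‖ ≤ ‖(P.comp (T y) - P.comp (T x)) a‖ + ‖P (T y a)‖ := by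
    have : a = -((P.comp (T y) - P.comp (T x)) a) + P (T y a) := by
      rw [hP]
      simp
    calc ‖a‖ = ‖-((P.comp (T y) - P.comp (T x)) a) + P (T y a)‖ := by rw [← this]
      _ ≤ _ := by
        rw [← norm_neg ((P.comp (T y) - P.comp (T x)) a)]
        exact norm_add_le _ _
  have h3 : ‖P (T y a)‖ ≤ ‖P‖ * ‖T y a‖ := P.le_opNorm _
  rw [← hT]
  linarith

variable {n : ℕ} {M : Type*} [TopologicalSpace M] [ChartedSpace (EuclideanSpace ℝ (Fin (2 * n))) M]
  [IsManifold (𝓡 (2 * n)) ∞ M] {k : ℕ}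

theorem contMDiffOn_lieDeriv {H : M → ℝ} (hH : ContMDiff (𝓡 (2 * n)) 𝓘(ℝ, ℝ) ∞ H)
    {X : ∀ x : M, TangentSpace (𝓡 (2 * n)) x} {U : Set M} (hX : IsSmoothFieldOn X U) :
    ContMDiffOn (𝓡 (2 * n)) 𝓘(ℝ, ℝ) ∞ (lieDeriv X H) U :=
  (contMDiff_snd_tangentBundle_modelSpace ℝ 𝓘(ℝ, ℝ)).comp_contMDiffOn
    ((hH.contMDiff_tangentMap (m := ∞) (by simp)).comp_contMDiffOn hX)

theorem contMDiffOn_frameMap {H : M → ℝ} (hH : ContMDiff (𝓡 (2 * n)) 𝓘(ℝ, ℝ) ∞ H)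
    {Y : Fin (2 * k) → ∀ x : M, TangentSpace (𝓡 (2 * n)) x} {U : Set M}
    (hY : ∀ i, IsSmoothFieldOn (Y i) U) :
    ContMDiffOn (𝓡 (2 * n)) (𝓡 (2 * k)) ∞ (frameMap Y H) U :=
  ((EuclideanSpace.equiv (Fin (2 * k)) ℝ).symm.contDiff.contMDiff).comp_contMDiffOn
    (contMDiffOn_pi_space.2 fun i => contMDiffOn_lieDeriv hH (hY i))

variable {Ω : SymplecticForm n M} {V : SymplecticDistribution Ω k}

namespace SymplecticDistribution

theorem exists_isSpanningFamilyOn (V : SymplecticDistribution Ω k) (x : M) :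
    ∃ Y U, V.IsSpanningFamilyOn Y U ∧ x ∈ U := by
  obtain ⟨U, Y, hU, hx, hY, hspan⟩ := V.smooth x
  exact ⟨Y, U, ⟨hU, hY, hspan⟩, hx⟩

/-- A point is critical if and only if `dH` vanishes on the fibre of `V`, because
`π_V(X_H) = 0` means that `X_H` is `ω`-orthogonal to `V`. -/
theorem mem_criticalSet_iff {H : M → ℝ} {x : M} :
    x ∈ V.criticalSet H ↔ ∀ v ∈ V.fiber x, differential H x v = 0 := by
  change V.proj x (hamiltonianField Ω H x) = 0 ↔ _
  rw [SymplecticDistribution.proj, Submodule.projection_apply_eq_zero_iff]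
  refine forall₂_congr fun v _ => ?_
  have hflip : Ω.bilin x v (hamiltonianField Ω H x) = 0 ↔
      Ω.bilin x (hamiltonianField Ω H x) v = 0 := (Ω.bilin_isAlt x).isRefl.eq_iff
  refine hflip.trans ?_
  rw [Ω.bilin_apply, form_hamiltonianField, neg_eq_zero]

variable {Y : Fin (2 * k) → ∀ x : M, TangentSpace (𝓡 (2 * n)) x} {U : Set M}

theorem IsSpanningFamilyOn.linearIndependent (h : V.IsSpanningFamilyOn Y U) {x : M} (hx : x ∈ U) :
    LinearIndependent ℝ fun i => Y i x := by
  rw [linearIndependent_iff_card_eq_finrank_span, Set.finrank, h.span_eq x hx, V.finrank_fiber,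
    Fintype.card_fin]

theorem IsSpanningFamilyOn.mem_fiber_iff (h : V.IsSpanningFamilyOn Y U) {x : M} (hx : x ∈ U)
    {v : TangentSpace (𝓡 (2 * n)) x} :
    v ∈ V.fiber x ↔ ∃ a : Fin (2 * k) → ℝ, ∑ i, a i • Y i x = v := by
  rw [← h.span_eq x hx, Submodule.mem_span_range_iff_exists_fun]

theorem IsSpanningFamilyOn.mem_criticalSet_iff (h : V.IsSpanningFamilyOn Y U) {H : M → ℝ} {x : M}
    (hx : x ∈ U) : x ∈ V.criticalSet H ↔ frameMap Y H x = 0 := by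
  rw [SymplecticDistribution.mem_criticalSet_iff]
  constructor
  · intro h0
    ext i
    exact h0 _ (h.span_eq x hx ▸ Submodule.subset_span ⟨i, rfl⟩)
  · intro h0 v hv
    obtain ⟨a, rfl⟩ := (h.mem_fiber_iff hx).1 hv
    rw [map_sum]
    refine Finset.sum_eq_zero fun i _ => ?_
    have : differential H x (Y i x) = 0 := congrArg (fun z => z.ofLp i) h0
    rw [map_smul, this, smul_zero]

theorem continuousAt_trivializationAt {X : ∀ x : M, TangentSpace (𝓡 (2 * n)) x} (hU : IsOpen U)
    (hX : IsSmoothFieldOn X U) {x : M} (hx : x ∈ U) :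
    ContinuousAt (fun y => (trivializationAt (EuclideanSpace ℝ (Fin (2 * n)))
      (TangentSpace (𝓡 (2 * n)) : M → Type _) x ⟨y, X y⟩).2) x :=
  ((Bundle.contMDiffAt_section x).1 (hX.contMDiffAt (hU.mem_nhds hx))).continuousAt

/-- Two frames of `V` differ by matrices that are locally bounded, and so do the corresponding
components of `dH`. -/
theorem IsSpanningFamilyOn.isBigO_frameMap {Y' : Fin (2 * k) → ∀ x : M, TangentSpace (𝓡 (2 * n)) x}
    {U' : Set M} (h : V.IsSpanningFamilyOn Y U) (h' : V.IsSpanningFamilyOn Y' U') {x : M}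
    (hx : x ∈ U) (hx' : x ∈ U') (H : M → ℝ) : frameMap Y H =O[𝓝 x] frameMap Y' H := by
  let e := trivializationAt (EuclideanSpace ℝ (Fin (2 * n)))
    (TangentSpace (𝓡 (2 * n)) : M → Type _) x
  have hxe : x ∈ e.baseSet := FiberBundle.mem_baseSet_trivializationAt' x
  let c : ∀ y : M, TangentSpace (𝓡 (2 * n)) y →ₗ[ℝ] EuclideanSpace ℝ (Fin (2 * n)) :=
    fun y => e.linearMapAt ℝ y
  have hc {y : M} (hy : y ∈ e.baseSet) (v : TangentSpace (𝓡 (2 * n)) y) :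
      c y v = (e ⟨y, v⟩).2 := by
    simp [c, e.coe_linearMapAt_of_mem (R := ℝ) hy]
  have hbase : ∀ᶠ y in 𝓝 x, y ∈ e.baseSet := e.open_baseSet.mem_nhds hxe
  have hcont {X : ∀ x : M, TangentSpace (𝓡 (2 * n)) x} {O : Set M} (hO : IsOpen O)
      (hX : IsSmoothFieldOn X O) (hxO : x ∈ O) : ContinuousAt (fun y => c y (X y)) x :=
    (continuousAt_trivializationAt hO hX hxO).congr (hbase.mono fun y hy => (hc hy _).symm)
  have hli : LinearIndependent ℝ fun j => c x (Y' j x) := by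
    refine (h'.linearIndependent hx').map' (c x) (LinearMap.ker_eq_bot.2 ?_)
    have : (c x : _ → _) = e.linearEquivAt ℝ x hxe := e.coe_linearMapAt_of_mem (R := ℝ) hxe
    rw [this]
    exact (e.linearEquivAt ℝ x hxe).injective
  obtain ⟨C, hC⟩ := eventually_norm_le_of_linearIndependent
    (fun j => hcont h'.isOpen (h'.smooth j) hx') hli
  have hO : (fun y => (frameMap Y H y).ofLp) =O[𝓝 x] frameMap Y' H := by
    refine Asymptotics.isBigO_pi.2 fun i => ?_
    have hb : ∀ᶠ y in 𝓝 x, ‖c y (Y i y)‖ < ‖c x (Y i x)‖ + 1 :=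
      (hcont h.isOpen (h.smooth i) hx).norm.eventually_lt continuousAt_const (by simp)
    refine Asymptotics.IsBigO.of_bound (∑ _j : Fin (2 * k), |C| * (‖c x (Y i x)‖ + 1)) ?_
    filter_upwards [hC, hb, h.isOpen.mem_nhds hx, h'.isOpen.mem_nhds hx'] with y hCy hby hyU hyU'
    obtain ⟨a, ha⟩ := (h'.mem_fiber_iff hyU').1
      ((h.span_eq y hyU ▸ Submodule.subset_span ⟨i, rfl⟩ : Y i y ∈ V.fiber y))
    have hay : ‖a‖ ≤ |C| * (‖c x (Y i x)‖ + 1) := by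
      refine (hCy a).trans ?_
      have : ∑ j, a j • c y (Y' j y) = c y (Y i y) := by rw [← ha, map_sum]; simp
      rw [this]
      exact mul_le_mul (le_abs_self C) hby.le (norm_nonneg _) (abs_nonneg C)
    have hval : (frameMap Y H y).ofLp i = ∑ j, a j * (frameMap Y' H y).ofLp j := by
      change differential H y (Y i y) = ∑ j, a j * differential H y (Y' j y)
      rw [← ha, map_sum]
      simp
    rw [hval, Finset.sum_mul]
    refine norm_sum_le_of_le _ fun j _ => ?_
    rw [norm_mul]
    exact mul_le_mul ((norm_le_pi_norm a j).trans hay) (PiLp.norm_apply_le _ j) (norm_nonneg _)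
      (by positivity)
  exact ((EuclideanSpace.equiv (Fin (2 * k)) ℝ).isBigO_comp_rev (frameMap Y H) (𝓝 x)).trans hO

theorem IsSpanningFamilyOn.mdifferentiableAt_frameMap (h : V.IsSpanningFamilyOn Y U) {H : M → ℝ}
    (hH : ContMDiff (𝓡 (2 * n)) 𝓘(ℝ, ℝ) ∞ H) {x : M} (hx : x ∈ U) :
    MDifferentiableAt (𝓡 (2 * n)) (𝓡 (2 * k)) (frameMap Y H) x :=
  ((contMDiffOn_frameMap hH h.smooth).contMDiffAt (h.isOpen.mem_nhds hx)).mdifferentiableAt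
    (by simp)

/-- At a critical point, regularity does not depend on the spanning family. -/
theorem IsSpanningFamilyOn.isRegularAt_of_isRegularAt
    {Y' : Fin (2 * k) → ∀ x : M, TangentSpace (𝓡 (2 * n)) x} {U' : Set M}
    (h : V.IsSpanningFamilyOn Y U) (h' : V.IsSpanningFamilyOn Y' U') {H : M → ℝ}
    (hH : ContMDiff (𝓡 (2 * n)) 𝓘(ℝ, ℝ) ∞ H) {x : M} (hx : x ∈ U) (hx' : x ∈ U')
    (hcrit : x ∈ V.criticalSet H) (hreg : IsRegularAt (n := n) (frameMap Y H) x) :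
    IsRegularAt (n := n) (frameMap Y' H) x :=
  isRegularAt_of_isBigO (h.mdifferentiableAt_frameMap hH hx) (h'.mdifferentiableAt_frameMap hH hx')
    (h.isBigO_frameMap h' hx hx' H) ((h'.mem_criticalSet_iff hx').1 hcrit) hreg

/-! ### The generic part of the critical set -/

theorem IsSpanningFamilyOn.isSmoothSubmanifold_level (h : V.IsSpanningFamilyOn Y U) {H : M → ℝ}
    (hH : ContMDiff (𝓡 (2 * n)) 𝓘(ℝ, ℝ) ∞ H) {c : EuclideanSpace ℝ (Fin (2 * k))}
    (hc : IsRegularValueOn (n := n) (frameMap Y H) U c) :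
    IsSmoothSubmanifold (n := n) (2 * (n - k)) {x ∈ U | frameMap Y H x = c} := by
  rw [Nat.mul_sub]
  refine isSmoothSubmanifold_of_locally fun p hp => ⟨frameMap Y H, U, h.isOpen, hp.1,
    contMDiffOn_frameMap hH h.smooth, hc p hp.1 hp.2, fun q hq => ?_⟩
  rw [hp.2]
  exact and_iff_right hq

theorem isSmoothSubmanifold_genericCriticalSet (V : SymplecticDistribution Ω k) {H : M → ℝ}
    (hH : ContMDiff (𝓡 (2 * n)) 𝓘(ℝ, ℝ) ∞ H) :
    IsSmoothSubmanifold (n := n) (2 * (n - k)) (V.genericCriticalSet H) := by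
  rw [Nat.mul_sub]
  refine isSmoothSubmanifold_of_locally fun p hp => ?_
  obtain ⟨hpc, Y, U, h, hpU, hreg⟩ := hp
  have hO := isOpen_setOf_isRegularAt h.isOpen (contMDiffOn_frameMap hH h.smooth)
  refine ⟨frameMap Y H, _, hO, ⟨hpU, hreg⟩,
    (contMDiffOn_frameMap hH h.smooth).mono fun x hx => hx.1, hreg, fun q hq => ?_⟩
  rw [(h.mem_criticalSet_iff hpU).1 hpc, ← h.mem_criticalSet_iff hq.1]
  exact ⟨fun hq' => hq'.1, fun hq' => ⟨hq', Y, U, h, hq.1, hq.2⟩⟩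

theorem exists_isOpen_genericCriticalSet_eq (V : SymplecticDistribution Ω k) {H : M → ℝ}
    (hH : ContMDiff (𝓡 (2 * n)) 𝓘(ℝ, ℝ) ∞ H) :
    ∃ O : Set M, IsOpen O ∧ V.genericCriticalSet H = V.criticalSet H ∩ O := by
  refine ⟨⋃ (Y) (U) (_ : V.IsSpanningFamilyOn Y U),
    {x ∈ U | IsRegularAt (n := n) (frameMap Y H) x}, ?_, ?_⟩
  · exact isOpen_iUnion fun Y => isOpen_iUnion fun U => isOpen_iUnion fun h =>
      isOpen_setOf_isRegularAt h.isOpen (contMDiffOn_frameMap hH h.smooth)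
  · ext x
    simp only [genericCriticalSet, Set.mem_inter_iff, Set.mem_iUnion, Set.mem_ofPred_eq,
      exists_prop]

theorem isGeneric_iff (V : SymplecticDistribution Ω k) {H : M → ℝ}
    (hH : ContMDiff (𝓡 (2 * n)) 𝓘(ℝ, ℝ) ∞ H) :
    V.IsGeneric H ↔ V.genericCriticalSet H = V.criticalSet H := by
  constructor
  · refine fun hgen => Set.Subset.antisymm (fun x hx => hx.1) fun x hx => ⟨hx, ?_⟩
    obtain ⟨Y, U, h, hxU⟩ := V.exists_isSpanningFamilyOn x
    exact ⟨Y, U, h, hxU, hgen Y U h x hxU ((h.mem_criticalSet_iff hxU).1 hx)⟩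
  · intro heq Y U h x hxU hx
    have hxc := (h.mem_criticalSet_iff hxU).2 hx
    obtain ⟨-, Y', U', h', hxU', hreg⟩ := heq.symm ▸ hxc
    exact h'.isRegularAt_of_isRegularAt h hH hxU' hxU hxc hreg

theorem isSmoothSubmanifold_criticalSet (V : SymplecticDistribution Ω k) {H : M → ℝ}
    (hH : ContMDiff (𝓡 (2 * n)) 𝓘(ℝ, ℝ) ∞ H) (hgen : V.IsGeneric H) :
    IsSmoothSubmanifold (n := n) (2 * (n - k)) (V.criticalSet H) :=
  (V.isGeneric_iff hH).1 hgen ▸ V.isSmoothSubmanifold_genericCriticalSet hH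

end SymplecticDistribution

end Frames

/-! ### Families of Hamiltonians -/

section Families

variable {n : ℕ} {M : Type*} [TopologicalSpace M] [ChartedSpace (EuclideanSpace ℝ (Fin (2 * n))) M]
  [IsManifold (𝓡 (2 * n)) ∞ M] {k N : ℕ} {Ω : SymplecticForm n M}
  {V : SymplecticDistribution Ω k} {H : M → ℝ} {f : Fin N → M → ℝ}

omit [IsManifold (𝓡 (2 * n)) ∞ M] in
theorem contMDiff_add_sum (hH : ContMDiff (𝓡 (2 * n)) 𝓘(ℝ, ℝ) ∞ H)
    (hf : ∀ j, ContMDiff (𝓡 (2 * n)) 𝓘(ℝ, ℝ) ∞ (f j)) (t : EuclideanSpace ℝ (Fin N)) :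
    ContMDiff (𝓡 (2 * n)) 𝓘(ℝ, ℝ) ∞ fun x => H x + ∑ j, t j * f j x :=
  hH.add (contMDiff_finsetSum fun j _ => contMDiff_const.mul (hf j))

omit [IsManifold (𝓡 (2 * n)) ∞ M] in
theorem frameMap_add_sum (hH : ContMDiff (𝓡 (2 * n)) 𝓘(ℝ, ℝ) ∞ H)
    (hf : ∀ j, ContMDiff (𝓡 (2 * n)) 𝓘(ℝ, ℝ) ∞ (f j))
    (Y : Fin (2 * k) → ∀ x : M, TangentSpace (𝓡 (2 * n)) x) (t : EuclideanSpace ℝ (Fin N)) (x : M) :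
    frameMap Y (fun x => H x + ∑ j, t j * f j x) x =
      frameMap Y H x + ∑ j, t j • frameMap Y (f j) x := by
  have hd (j) : MDifferentiableAt (𝓡 (2 * n)) 𝓘(ℝ, ℝ) (f j) x :=
    (hf j).mdifferentiable (by simp) x
  have hsum (s : Finset (Fin N)) : HasMFDerivAt (𝓡 (2 * n)) 𝓘(ℝ, ℝ)
      (fun x => ∑ j ∈ s, t j * f j x) x (∑ j ∈ s, t j • differential (f j) x) := by
    have := HasMFDerivAt.sum (t := s) fun j _ => ((hd j).hasMFDerivAt.const_smul (t j))
    have heq : (fun x => ∑ j ∈ s, t j * f j x) = ∑ j ∈ s, t j • f j := by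
      ext y
      simp
    rw [heq]
    exact this
  have h : differential (fun x => H x + ∑ j, t j * f j x) x =
      differential H x + ∑ j, t j • differential (f j) x :=
    (((hH.mdifferentiable (by simp) x).hasMFDerivAt).add (hsum Finset.univ)).mfderiv
  ext i
  simp [frameMap, lieDeriv, h]

/-- If the `df_j` separate the vectors of `V_x`, then they span its dual, so that every value of the
frame map at `x` is attained by some linear combination of the `f_j`. -/
theorem surjective_sum_frameMap
    (hsep : ∀ x, ∀ v ∈ V.fiber x, (∀ j, differential (f j) x v = 0) → v = 0)
    {Y : Fin (2 * k) → ∀ x : M, TangentSpace (𝓡 (2 * n)) x} {U : Set M}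
    (h : V.IsSpanningFamilyOn Y U) {x : M} (hx : x ∈ U) :
    Function.Surjective fun t : EuclideanSpace ℝ (Fin N) => ∑ j, t j • frameMap Y (f j) x := by
  have hbot : (Submodule.span ℝ (Set.range fun j => frameMap Y (f j) x))ᗮ = ⊥ := by
    refine (Submodule.eq_bot_iff _).2 fun c hc => ?_
    have hv : ∑ i, c i • Y i x = 0 := by
      refine hsep x _ ((h.mem_fiber_iff hx).2 ⟨c, rfl⟩) fun j => ?_
      have := (Submodule.mem_orthogonal _ _).1 hc _ (Submodule.subset_span ⟨j, rfl⟩)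
      rw [PiLp.inner_apply] at this
      rw [map_sum, ← this]
      refine Finset.sum_congr rfl fun i _ => ?_
      rw [map_smul]
      rfl
    ext i
    exact Fintype.linearIndependent_iff.1 (h.linearIndependent hx) c hv i
  intro z
  have hz : z ∈ Submodule.span ℝ (Set.range fun j => frameMap Y (f j) x) := by
    rw [Submodule.orthogonal_eq_bot_iff.1 hbot]
    trivial
  obtain ⟨t, ht⟩ := (Submodule.mem_span_range_iff_exists_fun ℝ).1 hz
  exact ⟨WithLp.toLp 2 t, ht⟩

/-- Parametric transversality, applied in charts to the frame maps of the family. -/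
theorem ae_isGeneric_add_sum [SecondCountableTopology M]
    (hH : ContMDiff (𝓡 (2 * n)) 𝓘(ℝ, ℝ) ∞ H)
    (hf : ∀ j, ContMDiff (𝓡 (2 * n)) 𝓘(ℝ, ℝ) ∞ (f j))
    (hsep : ∀ x, ∀ v ∈ V.fiber x, (∀ j, differential (f j) x v = 0) → v = 0) :
    ∀ᵐ t ∂(volume : Measure (EuclideanSpace ℝ (Fin N))),
      V.IsGeneric fun x => H x + ∑ j, t j * f j x := by
  suffices hgen : ∀ᵐ t ∂(volume : Measure (EuclideanSpace ℝ (Fin N))), ∀ x ∈ (Set.univ : Set M),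
      x ∈ V.criticalSet (fun x => H x + ∑ j, t j * f j x) →
        x ∈ V.genericCriticalSet fun x => H x + ∑ j, t j * f j x by
    filter_upwards [hgen] with t ht
    exact (V.isGeneric_iff (contMDiff_add_sum hH hf t)).2
      (Set.Subset.antisymm (fun x hx => hx.1) fun x hx => ht x trivial hx)
  refine ae_forall_mem_of_locally fun x _ => ?_
  obtain ⟨Y, U, h, hxU⟩ := V.exists_isSpanningFamilyOn x
  have hxs := mem_chart_source (EuclideanSpace ℝ (Fin (2 * n))) x
  have hW := isOpen_chartAt_target_inter (n := n) h.isOpen x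
  have hF := contDiffOn_comp_chartAt_symm (contMDiffOn_frameMap hH h.smooth) x
  have hFj (j) := contDiffOn_comp_chartAt_symm (contMDiffOn_frameMap (hf j) h.smooth) x
  have hreg {F : M → EuclideanSpace ℝ (Fin (2 * k))} {y : M} :=
    surjective_mfderiv_iff (n := n) (F := F) (x := x) (y := y)
  generalize chartAt (EuclideanSpace ℝ (Fin (2 * n))) x = φ at hxs hW hF hFj hreg
  let A : EuclideanSpace ℝ (Fin (2 * n)) →
      EuclideanSpace ℝ (Fin N) →L[ℝ] EuclideanSpace ℝ (Fin (2 * k)) := fun z =>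
    ∑ j, ContinuousLinearMap.smulRightL ℝ _ _ (EuclideanSpace.proj j)
      ((frameMap Y (f j) ∘ φ.symm) z)
  have hAt (z) (t : EuclideanSpace ℝ (Fin N)) :
      A z t = ∑ j, t j • frameMap Y (f j) (φ.symm z) := by simp [A]
  have hA : ContDiffOn ℝ ∞ A (φ.target ∩ φ.symm ⁻¹' U) :=
    ContDiffOn.sum fun j _ => ContDiff.comp_contDiffOn (ContinuousLinearMap.contDiff
      (ContinuousLinearMap.smulRightL ℝ (EuclideanSpace ℝ (Fin N)) (EuclideanSpace ℝ (Fin (2 * k)))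
        (EuclideanSpace.proj j))) (hFj j)
  have hsurj (z) (hz : z ∈ φ.target ∩ φ.symm ⁻¹' U) : Function.Surjective (A z) := by
    intro c
    obtain ⟨t, ht⟩ := surjective_sum_frameMap hsep h hz.2 c
    exact ⟨t, (hAt z t).trans ht⟩
  refine ⟨φ.source ∩ U, Filter.inter_mem (φ.open_source.mem_nhds hxs) (h.isOpen.mem_nhds hxU), ?_⟩
  filter_upwards [ae_surjective_fderiv_of_surjective volume hW hF hA hsurj] with t ht y hy hyc
  obtain ⟨⟨hys, hyU⟩, -⟩ := hy
  have hcomp : (fun z => (frameMap Y H ∘ φ.symm) z + A z t) =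
      frameMap Y (fun x => H x + ∑ j, t j * f j x) ∘ φ.symm := by
    funext z
    rw [hAt]
    exact (frameMap_add_sum hH hf Y t (φ.symm z)).symm
  have hy0 : (frameMap Y H ∘ φ.symm) (φ y) + A (φ y) t = 0 := by
    rw [← (h.mem_criticalSet_iff hyU).1 hyc]
    refine (congrFun hcomp (φ y)).trans ?_
    simp [φ.left_inv hys]
  have hregy := ht (φ y) ⟨φ.map_source hys, by simpa [φ.left_inv hys] using hyU⟩ hy0
  rw [hcomp] at hregy
  exact ⟨hyc, Y, U, h, hyU,
    (hreg hys (h.mdifferentiableAt_frameMap (contMDiff_add_sum hH hf t) hyU)).2 hregy⟩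

end Families

end ConstrainedHamiltonian

theorem mainTheorem2 {n k : ℕ} {M : Type*} [TopologicalSpace M] [T2Space M]
    [SecondCountableTopology M] [ChartedSpace (EuclideanSpace ℝ (Fin (2 * n))) M]
    [IsManifold (𝓡 (2 * n)) ∞ M] (Ω : ConstrainedHamiltonian.SymplecticForm n M)
    (V : ConstrainedHamiltonian.SymplecticDistribution Ω k)
    (H : M → ℝ) (hH : ContMDiff (𝓡 (2 * n)) 𝓘(ℝ, ℝ) ∞ H) :
    -- `C` is locally the zero set of the smooth map `F`, and every point has such an `F`
    (∀ x : M, ∃ Y U, V.IsSpanningFamilyOn Y U ∧ x ∈ U) ∧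
    (∀ Y U, V.IsSpanningFamilyOn Y U →
      ContMDiffOn (𝓡 (2 * n)) (𝓡 (2 * k)) ∞ (ConstrainedHamiltonian.frameMap Y H) U ∧
      V.criticalSet H ∩ U = {x ∈ U | ConstrainedHamiltonian.frameMap Y H x = 0}) ∧
    -- almost all values of `F` are regular, they are dense, and have submanifolds as preimages
    (∀ Y U, V.IsSpanningFamilyOn Y U →
      (∀ᵐ c ∂(MeasureTheory.volume : MeasureTheory.Measure (EuclideanSpace ℝ (Fin (2 * k)))),
        ConstrainedHamiltonian.IsRegularValueOn (n := n)
          (ConstrainedHamiltonian.frameMap Y H) U c) ∧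
      Dense {c | ConstrainedHamiltonian.IsRegularValueOn (n := n)
          (ConstrainedHamiltonian.frameMap Y H) U c} ∧
      ∀ c, ConstrainedHamiltonian.IsRegularValueOn (n := n)
          (ConstrainedHamiltonian.frameMap Y H) U c →
        ConstrainedHamiltonian.IsSmoothSubmanifold (n := n) (2 * (n - k))
          {x ∈ U | ConstrainedHamiltonian.frameMap Y H x = c}) ∧
    -- the generic part of `C` is relatively open in `C` and a submanifold
    ((∃ O : Set M, IsOpen O ∧ V.genericCriticalSet H = V.criticalSet H ∩ O) ∧
      ConstrainedHamiltonian.IsSmoothSubmanifold (n := n) (2 * (n - k))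
        (V.genericCriticalSet H)) ∧
    -- genericity does not depend on the spanning families, and then `C` is a submanifold
    (V.IsGeneric H ↔ V.genericCriticalSet H = V.criticalSet H) ∧
    (V.IsGeneric H →
      ConstrainedHamiltonian.IsSmoothSubmanifold (n := n) (2 * (n - k)) (V.criticalSet H)) ∧
    -- in families of Hamiltonians that are rich enough, almost every member is generic
    (∀ (N : ℕ) (f : Fin N → M → ℝ), (∀ j, ContMDiff (𝓡 (2 * n)) 𝓘(ℝ, ℝ) ∞ (f j)) →
      (∀ x, ∀ v ∈ V.fiber x, (∀ j, ConstrainedHamiltonian.differential (f j) x v = 0) → v = 0) →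
      ∀ᵐ t ∂(MeasureTheory.volume : MeasureTheory.Measure (EuclideanSpace ℝ (Fin N))),
        V.IsGeneric (fun x => H x + ∑ j, t j * f j x) ∧
        ConstrainedHamiltonian.IsSmoothSubmanifold (n := n) (2 * (n - k))
          (V.criticalSet (fun x => H x + ∑ j, t j * f j x))) := by

  refine ⟨V.exists_isSpanningFamilyOn, fun Y U h => ⟨?_, ?_⟩, fun Y U h => ?_,
    ⟨V.exists_isOpen_genericCriticalSet_eq hH, V.isSmoothSubmanifold_genericCriticalSet hH⟩,
    V.isGeneric_iff hH, V.isSmoothSubmanifold_criticalSet hH, fun N f hf hsep => ?_⟩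
  · exact ConstrainedHamiltonian.contMDiffOn_frameMap hH h.smooth
  · ext x
    exact ⟨fun hx => ⟨hx.2, (h.mem_criticalSet_iff hx.2).1 hx.1⟩,
      fun hx => ⟨(h.mem_criticalSet_iff hx.1).2 hx.2, hx.1⟩⟩
  · have hae := ConstrainedHamiltonian.ae_isRegularValueOn h.isOpen
      (ConstrainedHamiltonian.contMDiffOn_frameMap hH h.smooth)
    exact ⟨hae, MeasureTheory.Measure.dense_of_ae hae,
      fun c hc => h.isSmoothSubmanifold_level hH hc⟩
  · filter_upwards [ConstrainedHamiltonian.ae_isGeneric_add_sum hH hf hsep] with t ht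
    exact ⟨ht, V.isSmoothSubmanifold_criticalSet
      (ConstrainedHamiltonian.contMDiff_add_sum hH hf t) ht⟩
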